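/- **Conventions.** A 2-CNF on $n$ Boolean variables is a set of clauses, each clause being an unordered pair of literals of two distinct variables. Its implication digraph has the $2n$ literals as vertices, and each clause $k\vee\ell$ contributes the two arcs $\overline k\to\ell$ and $\overline\ell\to k$; an implication digraph is a digraph obtained in this way. A strongly connected component (SCC) is a nonempty set of vertices, maximal with the property that any two of its vertices are joined by oriented paths in both directions. An SCC of an implication digraph is contradictory if it contains a literal of a variable $x$ for which there are oriented paths from $x$ to $\overline x$ and from $\overline x$ to $x$; otherwise it is ordinary. An SCC is source-like (resp. sink-like) if no arc enters it from outside (resp. leaves it), and isolated if it is both. If $C$ is an isolated ordinary SCC, then so is the set $\overline C$ of negations of its literals; $\{C,\overline C\}$ is called an isolated ordinary component pair. All generating functions are formal power series in $z$; the variable $w$ is omitted from the notation. For an implication digraph, $z$ marks the Boolean variables (half the number of vertices) and $w$ marks the clauses (half the number of arcs); for a digraph, $z$ marks the vertices and $w$ the arcs. Write $$\Big(\sum_{n\ge0} a_n\frac{z^n}{n!}\Big)\odot_z\Big(\sum_{n\ge0} b_n\frac{z^n}{n!}\Big)=\sum_{n\ge0} a_nb_n\frac{z^n}{n!},\qquad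 D(z)=\sum_{n\ge0}(1+w)^{n(n-1)}\frac{z^n}{n!},$$ $$\widehat{\mathrm{Set}}(z)=\sum_{n\ge0}\frac{1}{(1+w)^{\binom n2}}\frac{z^n}{n!},\qquad \ddot{\mathrm{Set}}(z)=\sum_{n\ge0}\frac{1}{(1+w)^{n(n-1)}}\frac{z^n}{2^n\,n!}.$$ Let $\mathrm{SCC}(z)$ be the exponential generating function of labeled, nonempty, strongly connected digraphs without loops or multiple arcs, and let $\mathrm{CSCC}(z)$ be the exponential generating function of implication digraphs that consist of a single, contradictory, SCC. **Theorem.** Let $\mathrm{CNF}(z,u,v,s)$ be the exponential generating function of all implication digraphs, where $u$ marks the non-isolated source-like ordinary SCCs, $v$ the isolated ordinary component pairs, and $s$ the contradictory SCCs. Then $$\mathrm{CNF}(z,u,v,s)=e^{(v+1-2u)\,\mathrm{SCC}(2z)/2}\left(D(2z)\odot_z\left[\frac{\left(e^{(u-1)\mathrm{SCC}(z)}\odot_z\widehat{\mathrm{Set}}(z)\right)\left(e^{s\,\mathrm{CSCC}(z)-\mathrm{SCC}(2z)/2}\odot_z\ddot{\mathrm{Set}}(z)\right)}{e^{-\mathrm{SCC}(z)}\odot_z\widehat{\mathrm{Set}}(z)}\right]\right).$$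 -/

import Mathlib

open PowerSeries

noncomputable section

namespace TwoSat

/-! ### Strongly connected components of a digraph -/

/-- There is an oriented path (possibly of length zero) from `x` to `y`. -/
def Reach {V : Type} (G : Digraph V) (x y : V) : Prop :=
  Relation.ReflTransGen G.Adj x y

/-- A strongly connected component: a nonempty set of vertices, maximal for inclusion with the
property that there is an oriented path from any vertex of the set to any other one. -/
def IsSCC {V : Type} (G : Digraph V) (C : Set V) : Prop :=
  C.Nonempty ∧ Maximal (fun S : Set V => ∀ x ∈ S, ∀ y ∈ S, Reach G x y) C

/-- No arc enters `C` from outside. -/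
def SourceLike {V : Type} (G : Digraph V) (C : Set V) : Prop :=
  ∀ x ∉ C, ∀ y ∈ C, ¬ G.Adj x y

/-- No arc leaves `C`. -/
def SinkLike {V : Type} (G : Digraph V) (C : Set V) : Prop :=
  ∀ x ∈ C, ∀ y ∉ C, ¬ G.Adj x y

def Isolated {V : Type} (G : Digraph V) (C : Set V) : Prop :=
  SourceLike G C ∧ SinkLike G C

/-- A strongly connected digraph has at least one vertex and is a single component. -/
def StronglyConnected {V : Type} (G : Digraph V) : Prop :=
  IsSCC G Set.univ

/-! ### Labeled digraphs, 2-CNFs and implication digraphs -/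

/-- The digraph on `n` labeled vertices with a given set of arcs. -/
def digraphOfArcs {n : ℕ} (A : Finset (Fin n × Fin n)) : Digraph (Fin n) where
  Adj x y := (x, y) ∈ A

/-- The arc sets of all digraphs on `n` labeled vertices without loops or multiple arcs. -/
def arcSets (n : ℕ) : Finset (Finset (Fin n × Fin n)) :=
  (Finset.univ : Finset (Fin n)).offDiag.powerset

/-- The literals of `n` Boolean variables: `(i, true)` is the variable `i`, and `(i, false)` is
its negation. -/
abbrev Literal (n : ℕ) : Type := Fin n × Bool

/-- The negation of a literal. -/
def neg {n : ℕ} (x : Literal n) : Literal n := (x.1, !x.2)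

/-- The 2-clauses on `n` variables: unordered pairs of literals of distinct variables. -/
def clauses (n : ℕ) : Finset (Sym2 (Literal n)) :=
  Finset.univ.filter fun c => ¬ (c.map Prod.fst).IsDiag

/-- The 2-CNFs on `n` variables: all sets of 2-clauses. -/
def twoCNFs (n : ℕ) : Finset (Finset (Sym2 (Literal n))) :=
  (clauses n).powerset

/-- The implication digraph of a 2-CNF: the clause `k ∨ l` gives the two arcs
`¬k → l` and `¬l → k`. A 2-CNF with `n` variables and `m` clauses is determined by its
implication digraph, which has `2n` vertices and `2m` arcs. -/
def implicationDigraph {n : ℕ} (F : Finset (Sym2 (Literal n))) : Digraph (Literal n) where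
  Adj x y := s(neg x, y) ∈ F

/-- The variable `i` is contradictory: there are oriented paths both ways between its two
literals. -/
def ContradictoryVar {n : ℕ} (G : Digraph (Literal n)) (i : Fin n) : Prop :=
  Reach G (i, true) (i, false) ∧ Reach G (i, false) (i, true)

/-- A contradictory component: one that contains a (literal of a) contradictory variable. -/
def IsContradictorySCC {n : ℕ} (G : Digraph (Literal n)) (C : Set (Literal n)) : Prop :=
  IsSCC G C ∧ ∃ x ∈ C, ContradictoryVar G x.1

def IsOrdinarySCC {n : ℕ} (G : Digraph (Literal n)) (C : Set (Literal n)) : Prop :=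
  IsSCC G C ∧ ¬ IsContradictorySCC G C

/-- The number of source-like, non-isolated ordinary components. -/
def numSource {n : ℕ} (G : Digraph (Literal n)) : ℕ :=
  {C : Set (Literal n) | IsOrdinarySCC G C ∧ SourceLike G C ∧ ¬ Isolated G C}.ncard

/-- The number of unordered pairs `{C, ¬C}` where `C` is an isolated ordinary component and `¬C`
is the set of negations of its literals. -/
def numIsolatedPairs {n : ℕ} (G : Digraph (Literal n)) : ℕ :=
  {P : Sym2 (Set (Literal n)) |
    ∃ C, IsOrdinarySCC G C ∧ Isolated G C ∧ P = s(C, neg '' C)}.ncard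

/-- The number of contradictory components. -/
def numContradictory {n : ℕ} (G : Digraph (Literal n)) : ℕ :=
  {C : Set (Literal n) | IsContradictorySCC G C}.ncard

/-! ### Marking variables and operations on series in `z` -/

/-- The formal variables besides `z`: `w` marks arcs of digraphs and clauses of 2-CNFs. -/
inductive Mark : Type
  | w | u | v | s

/-- The field `ℚ(w, u, v, s)` of rational functions. All generating functions are formal power
series in `z` over it. -/
abbrev K : Type := FractionRing (MvPolynomial Mark ℚ)

def w : K := algebraMap (MvPolynomial Mark ℚ) K (MvPolynomial.X Mark.w)

def u : K := algebraMap (MvPolynomial Mark ℚ) K (MvPolynomial.X Mark.u)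

def v : K := algebraMap (MvPolynomial Mark ℚ) K (MvPolynomial.X Mark.v)

def s : K := algebraMap (MvPolynomial Mark ℚ) K (MvPolynomial.X Mark.s)

/-- The exponential generating function `∑ aₙ zⁿ / n!`. -/
def egf (a : ℕ → K) : K⟦X⟧ :=
  PowerSeries.mk fun n => a n / (n.factorial : K)

/-- The exponential Hadamard product with respect to `z`:
`(∑ aₙ zⁿ / n!) ⊙ (∑ bₙ zⁿ / n!) = ∑ aₙ bₙ zⁿ / n!`, where `aₙ = n! [zⁿ] A`. -/
def hadamard (A B : K⟦X⟧) : K⟦X⟧ :=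
  egf fun n => ((n.factorial : K) * coeff n A) * ((n.factorial : K) * coeff n B)

/-- The exponential `e^A` of a series `A` in `z` without constant term. -/
def expS (A : K⟦X⟧) : K⟦X⟧ := (PowerSeries.exp K).subst A

/-- `A(2z)`. -/
def atTwoZ (A : K⟦X⟧) : K⟦X⟧ := PowerSeries.rescale (2 : K) A

/-! ### The generating functions -/

/-- `D(z) = ∑ (1+w)^(n(n-1)) zⁿ / n!`, the exponential generating function of all digraphs. -/
def D : K⟦X⟧ := egf fun n => (1 + w) ^ (n * (n - 1))

/-- `∑ (1+w)^(-n(n-1)/2) zⁿ / n!`, the graphic generating function of digraphs without arcs. -/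
def SetHat : K⟦X⟧ := egf fun n => 1 / (1 + w) ^ n.choose 2

/-- `∑ (1+w)^(-n(n-1)) zⁿ / (2ⁿ n!)`, the implication generating function of implication digraphs
without arcs. -/
def SetDdot : K⟦X⟧ := egf fun n => 1 / ((1 + w) ^ (n * (n - 1)) * 2 ^ n)

open Classical in
/-- The exponential generating function of strongly connected digraphs. -/
def SCC : K⟦X⟧ :=
  egf fun n => ∑ A ∈ arcSets n with StronglyConnected (digraphOfArcs A), w ^ A.card

open Classical in
/-- The exponential generating function of contradictory strongly connected components, that is,
of the implication digraphs that consist of a single, contradictory, component; `z` marks Boolean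
variables and `w` marks clauses. -/
def CSCC : K⟦X⟧ :=
  egf fun n => ∑ F ∈ twoCNFs n with IsContradictorySCC (implicationDigraph F) Set.univ,
    w ^ F.card

/-- The exponential generating function of all implication digraphs: `z` marks Boolean variables,
`w` clauses, `u` non-isolated source-like ordinary components, `v` pairs of isolated ordinary
components, and `s` contradictory components. -/
def CNF : K⟦X⟧ :=
  egf fun n => ∑ F ∈ twoCNFs n,
    w ^ F.card * u ^ numSource (implicationDigraph F)
      * v ^ numIsolatedPairs (implicationDigraph F)
      * s ^ numContradictory (implicationDigraph F)

end TwoSat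

end

open PowerSeries

noncomputable section

namespace TwoSat

/-! ### Exponential generating functions -/

/-! The proof is an inclusion-exclusion on source-like components, carried out for arbitrary weights
and then inverted at one well-chosen specialization.

Negation of literals reverses all arcs. Hence the negation of a source-like ordinary component is
sink-like, and it is again source-like exactly when the component is isolated. Give weight `1 + t`
to each non-isolated source-like ordinary component and `1 + 2 * (t + ρ)` to each isolated pair.
Expanding the product amounts to distinguishing a family `T` of source-like components (weight `t`
each) and a family `Q` of isolated ones (weight `ρ` each), disjoint and never containing two
opposite components: an isolated pair is left alone, or one of its two members is put in one of the
two families (`weight_eq_sum`).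

Once `T` and `Q` are prescribed, the 2-CNF splits into independent pieces (`sum_hasComponents`): a
strongly connected digraph on each member, an arbitrary set of clauses going out of the `k` literals
covered by `T`, and an arbitrary 2-CNF on the `m` variables not covered. There are `k.choose 2 + 2 *
k * m` possible outgoing clauses, and all contradictory components lie in the last piece. Each
covered variable may appear with either sign, which produces the powers of 2 and the series at `2z`.
By the exponential formula, and since the exponents of `1 + w` add up (`add_mul_pred`), this becomes
the product formula `egf_cnfCoeff`, whose only unknown factor is `implicationSeries x`, the series
of all 2-CNFs with just the contradictory components marked.

To find that factor, take `t = -1` and `ρ = 1/2`, so that both weights vanish. What survives are the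
2-CNFs without ordinary source-like components. In these, every literal is reached from a
contradictory source-like component, and skew symmetry places it inside that component; so the
digraph is a disjoint union of contradictory components, with series `expS (x • CSCC)`
(`egf_cnfCoeff_zero`). Solving for the unknown gives `implicationSeries_eq`. The theorem is the
product formula at `t = u - 1`, `ρ = (v + 1 - 2 * u) / 2`. -/

theorem factorial_ne_zero' (n : ℕ) : (n.factorial : K) ≠ 0 :=
  Nat.cast_ne_zero.mpr n.factorial_ne_zero

theorem coeff_egf (a : ℕ → K) (n : ℕ) : coeff n (egf a) = a n / (n.factorial : K) :=
  coeff_mk _ _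

theorem factorial_mul_coeff_egf (a : ℕ → K) (n : ℕ) :
    (n.factorial : K) * coeff n (egf a) = a n := by
  rw [coeff_egf, mul_div_cancel₀ _ (factorial_ne_zero' n)]

theorem egf_factorial_mul_coeff (A : K⟦X⟧) :
    egf (fun n => (n.factorial : K) * coeff n A) = A := by
  ext n
  rw [coeff_egf, mul_div_cancel_left₀ _ (factorial_ne_zero' n)]

theorem constantCoeff_egf (a : ℕ → K) : constantCoeff (egf a) = a 0 := by
  rw [← coeff_zero_eq_constantCoeff_apply, coeff_egf]
  simp

theorem hadamard_egf (a b : ℕ → K) :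
    hadamard (egf a) (egf b) = egf fun n => a n * b n := by
  simp only [hadamard, factorial_mul_coeff_egf]

theorem atTwoZ_egf (a : ℕ → K) : atTwoZ (egf a) = egf fun n => 2 ^ n * a n := by
  ext n
  rw [atTwoZ, coeff_rescale, coeff_egf, coeff_egf, mul_div_assoc]

theorem smul_egf (c : K) (a : ℕ → K) : c • egf a = egf fun n => c * a n := by
  ext n
  rw [coeff_smul, coeff_egf, coeff_egf, smul_eq_mul, mul_div_assoc]

theorem egf_mul_egf (a b : ℕ → K) :
    egf a * egf b =
      egf fun n => ∑ k ∈ Finset.range (n + 1), (n.choose k : K) * (a k * b (n - k)) := by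
  ext n
  rw [coeff_mul, coeff_egf, Finset.Nat.sum_antidiagonal_eq_sum_range_succ_mk, Finset.sum_div]
  refine Finset.sum_congr rfl fun k hk => ?_
  have hk : k ≤ n := Nat.lt_succ_iff.mp (Finset.mem_range.mp hk)
  rw [coeff_egf, coeff_egf, Nat.cast_choose K hk]
  have h1 := factorial_ne_zero' k
  have h2 := factorial_ne_zero' (n - k)
  have h3 := factorial_ne_zero' n
  field_simp

theorem derivative_egf (a : ℕ → K) : d⁄dX K (egf a) = egf fun n => a (n + 1) := by
  ext n
  rw [coeff_derivative, coeff_egf, coeff_egf, Nat.factorial_succ]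
  have h1 := factorial_ne_zero' n
  have h2 : (n : K) + 1 ≠ 0 := Nat.cast_add_one_ne_zero n
  push_cast
  field_simp

/-! ### Exponentials of power series -/

theorem constantCoeff_expS {A : K⟦X⟧} (hA : constantCoeff A = 0) :
    constantCoeff (expS A) = 1 := by
  have hs : HasSubst A := HasSubst.of_constantCoeff_zero' hA
  rw [expS, ← coeff_zero_eq_constantCoeff_apply, coeff_subst' hs, finsum_eq_single _ 0]
  · simp
  · intro n hn
    simp [hA, hn]

theorem derivative_expS {A : K⟦X⟧} (hA : constantCoeff A = 0) :
    d⁄dX K (expS A) = d⁄dX K A * expS A := by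
  rw [expS, derivative_subst (HasSubst.of_constantCoeff_zero' hA), derivative_exp, mul_comm]

/-- Uniqueness for the linear equation `f' = A' f`: the quotient of `f` by `expS A` has derivative
zero and constant term 1. Additivity and the coefficient recurrence of the exponential both rest on
this. -/
theorem eq_expS {A f : K⟦X⟧} (hA : constantCoeff A = 0) (h0 : constantCoeff f = 1)
    (h : d⁄dX K f = d⁄dX K A * f) : f = expS A := by
  have hE : constantCoeff (expS A) ≠ 0 := by
    rw [constantCoeff_expS hA]
    exact one_ne_zero
  have key : f * (expS A)⁻¹ = 1 := by
    apply derivative.ext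
    · rw [Derivation.leibniz, derivative_inv', h, derivative_expS hA, derivative_one]
      simp only [smul_eq_mul]
      have := PowerSeries.mul_inv_cancel _ hE
      linear_combination (-(f * (expS A)⁻¹ * d⁄dX K A)) * this
    · simp [h0, constantCoeff_expS hA]
  rw [← mul_one f, ← PowerSeries.inv_mul_cancel _ hE, ← mul_assoc, key, one_mul]

theorem expS_add {A B : K⟦X⟧} (hA : constantCoeff A = 0) (hB : constantCoeff B = 0) :
    expS (A + B) = expS A * expS B := by
  symm
  apply eq_expS
  · simp [hA, hB]
  · simp [constantCoeff_expS, hA, hB]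
  · rw [Derivation.leibniz, derivative_expS hA, derivative_expS hB, map_add]
    simp only [smul_eq_mul]
    ring

/-- The coefficients of the exponential of an exponential generating function. -/
def expCoeff (a : ℕ → K) (n : ℕ) : K := (n.factorial : K) * coeff n (expS (egf a))

theorem egf_expCoeff (a : ℕ → K) : egf (expCoeff a) = expS (egf a) :=
  egf_factorial_mul_coeff _

theorem expCoeff_zero {a : ℕ → K} (ha : a 0 = 0) : expCoeff a 0 = 1 := by
  rw [expCoeff, coeff_zero_eq_constantCoeff_apply,
    constantCoeff_expS ((constantCoeff_egf a).trans ha)]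
  simp

theorem egf_injective : Function.Injective egf := fun a b h => by
  funext n
  rw [← factorial_mul_coeff_egf a n, h, factorial_mul_coeff_egf]

/-- Coefficients of `E' = A' E`. Combinatorially, `k + 1` is the size of the block that contains a
marked element, which is how it meets `sum_partitions_insert`. -/
theorem expCoeff_succ {a : ℕ → K} (ha : a 0 = 0) (n : ℕ) :
    expCoeff a (n + 1) =
      ∑ k ∈ Finset.range (n + 1), (n.choose k : K) * (a (k + 1) * expCoeff a (n - k)) := by
  have h := derivative_expS ((constantCoeff_egf a).trans ha)
  rw [← egf_expCoeff, derivative_egf, derivative_egf, egf_mul_egf] at h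
  exact congrFun (egf_injective h) n

theorem eq_expCoeff {a f : ℕ → K} (ha : a 0 = 0) (h0 : f 0 = 1)
    (h : ∀ n, f (n + 1) =
      ∑ k ∈ Finset.range (n + 1), (n.choose k : K) * (a (k + 1) * f (n - k))) :
    f = expCoeff a := by
  apply egf_injective
  rw [egf_expCoeff]
  apply eq_expS ((constantCoeff_egf a).trans ha) ((constantCoeff_egf f).trans h0)
  rw [derivative_egf, derivative_egf, egf_mul_egf]
  exact congrArg egf (funext h)

theorem expCoeff_two_pow_mul {a : ℕ → K} (ha : a 0 = 0) (n : ℕ) :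
    expCoeff (fun k => 2 ^ k * a k) n = 2 ^ n * expCoeff a n := by
  refine (congrFun (eq_expCoeff (f := fun n => 2 ^ n * expCoeff a n) ?_ ?_ fun n => ?_) n).symm
  · simp [ha]
  · simp [expCoeff_zero ha]
  · rw [expCoeff_succ ha, Finset.mul_sum]
    refine Finset.sum_congr rfl fun k hk => ?_
    have hk : k ≤ n := Nat.lt_succ_iff.mp (Finset.mem_range.mp hk)
    have : (2 : K) ^ (n + 1) = 2 ^ (k + 1) * 2 ^ (n - k) := by
      rw [← pow_add]
      congr 1
      omega
    rw [this]
    ring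

/-! ### Set partitions and the exponential formula -/

section Partitions

variable {α : Type} [DecidableEq α]

open Classical in
/-- The partitions of a finite set into nonempty blocks. -/
def partitions (S : Finset α) : Finset (Finset (Finset α)) :=
  S.powerset.powerset.filter fun P =>
    ∅ ∉ P ∧ (P : Set (Finset α)).PairwiseDisjoint id ∧ P.biUnion id = S

theorem mem_partitions {S : Finset α} {P : Finset (Finset α)} :
    P ∈ partitions S ↔
      ∅ ∉ P ∧ (P : Set (Finset α)).PairwiseDisjoint id ∧ P.biUnion id = S := by
  unfold partitions
  rw [@Finset.mem_filter _ _ (_), and_iff_right_iff_imp]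
  rintro ⟨-, -, rfl⟩
  rw [Finset.mem_powerset]
  intro B hB
  rw [Finset.mem_powerset]
  exact Finset.subset_biUnion_of_mem id hB

theorem partitions_empty : partitions (∅ : Finset α) = {∅} := by
  ext P
  rw [mem_partitions, Finset.mem_singleton]
  constructor
  · rintro ⟨h0, -, h⟩
    rw [Finset.eq_empty_iff_forall_notMem]
    intro B hB
    have hBe : B ⊆ ∅ := h ▸ Finset.subset_biUnion_of_mem id hB
    exact h0 (Finset.subset_empty.mp hBe ▸ hB)
  · rintro rfl
    simp

theorem insert_mem_partitions {x : α} {S B : Finset α} (hx : x ∉ S) (hB : B ⊆ S)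
    {P : Finset (Finset α)} (hP : P ∈ partitions (S \ B)) :
    insert (insert x B) P ∈ partitions (insert x S) ∧ insert x B ∉ P := by
  rw [mem_partitions] at hP
  obtain ⟨h0, hd, hU⟩ := hP
  have hsub : ∀ C ∈ P, C ⊆ S \ B := fun C hC => hU ▸ Finset.subset_biUnion_of_mem id hC
  refine ⟨?_, fun h => ?_⟩
  · rw [mem_partitions]
    refine ⟨?_, ?_, ?_⟩
    · rw [Finset.mem_insert, not_or]
      exact ⟨(Finset.insert_ne_empty _ _).symm, h0⟩
    · rw [Finset.coe_insert, Set.pairwiseDisjoint_insert]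
      refine ⟨hd, fun C hC _ => ?_⟩
      rw [id, id, Finset.disjoint_left]
      intro y hy hyC
      have := Finset.mem_sdiff.mp (hsub C hC hyC)
      rcases Finset.mem_insert.mp hy with rfl | hy
      · exact hx this.1
      · exact this.2 hy
    · rw [Finset.biUnion_insert, hU, id, Finset.insert_union,
        Finset.union_sdiff_of_subset hB]
  · exact hx (Finset.mem_sdiff.mp (hsub _ h (Finset.mem_insert_self x B))).1

/-- A partition is determined by the block containing `x`, written `insert x B`, and a partition of
what is left. -/
theorem sum_partitions_insert {R : Type} [CommSemiring R] {x : α} {S : Finset α} (hx : x ∉ S)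
    (a : Finset α → R) :
    ∑ P ∈ partitions (insert x S), ∏ B ∈ P, a B =
      ∑ B ∈ S.powerset, a (insert x B) * ∑ P ∈ partitions (S \ B), ∏ C ∈ P, a C := by
  simp only [Finset.mul_sum]
  rw [Finset.sum_sigma']
  symm
  refine Finset.sum_bij (fun p _ => insert (insert x p.1) p.2) ?_ ?_ ?_ ?_
  · rintro ⟨B, P⟩ h
    rw [Finset.mem_sigma, Finset.mem_powerset] at h
    exact (insert_mem_partitions hx h.1 h.2).1
  · rintro ⟨B, P⟩ h ⟨B', P'⟩ h' heq
    rw [Finset.mem_sigma, Finset.mem_powerset] at h h'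
    obtain ⟨h1, h2⟩ := insert_mem_partitions hx h.1 h.2
    obtain ⟨h1', h2'⟩ := insert_mem_partitions hx h'.1 h'.2
    dsimp only at heq h1 h1' h2 h2' h h'
    have hBB : insert x B = insert x B' := by
      by_contra hne
      have hd := (mem_partitions.mp h1).2.1
      have := hd (Finset.mem_coe.mpr (Finset.mem_insert_self _ _))
        (Finset.mem_coe.mpr (heq ▸ Finset.mem_insert_self _ _)) hne
      exact Finset.disjoint_left.mp this (Finset.mem_insert_self _ _)
        (Finset.mem_insert_self _ _)
    have hB : B = B' := by
      rw [← Finset.erase_insert (fun hh => hx (h.1 hh) : x ∉ B), hBB,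
        Finset.erase_insert (fun hh => hx (h'.1 hh) : x ∉ B')]
    subst hB
    have hP : P = P' := by
      rw [← Finset.erase_insert h2, heq, Finset.erase_insert h2']
    rw [hP]
  · intro P hP
    obtain ⟨h0, hd, hU⟩ := mem_partitions.mp hP
    have hxU : x ∈ P.biUnion id := hU ▸ Finset.mem_insert_self x S
    obtain ⟨B, hB, hxB⟩ := Finset.mem_biUnion.mp hxU
    rw [id] at hxB
    have hBsub : B ⊆ insert x S := hU ▸ Finset.subset_biUnion_of_mem id hB
    refine ⟨⟨B.erase x, P.erase B⟩, ?_, ?_⟩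
    · rw [Finset.mem_sigma, Finset.mem_powerset, mem_partitions]
      refine ⟨?_, ?_, ?_, ?_⟩
      · rwa [← Finset.subset_insert_iff]
      · exact fun h => h0 (Finset.mem_of_mem_erase h)
      · exact hd.subset (Finset.coe_subset.mpr (Finset.erase_subset _ _))
      · ext y
        simp only [Finset.mem_biUnion, Finset.mem_erase, id, Finset.mem_sdiff, not_and]
        constructor
        · rintro ⟨C, ⟨hne, hC⟩, hy⟩
          have hdis := Finset.disjoint_left.mp (hd (Finset.mem_coe.mpr hC) hB hne)
          have hy' : y ∈ insert x S := hU ▸ Finset.mem_biUnion.mpr ⟨C, hC, hy⟩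
          rcases Finset.mem_insert.mp hy' with rfl | hy'
          · exact absurd hxB (hdis hy)
          · exact ⟨hy', fun _ => hdis hy⟩
        · rintro ⟨hyS, hyB⟩
          have hy' : y ∈ P.biUnion id := hU ▸ Finset.mem_insert_of_mem hyS
          obtain ⟨C, hC, hy⟩ := Finset.mem_biUnion.mp hy'
          refine ⟨C, ⟨?_, hC⟩, hy⟩
          rintro rfl
          exact hyB (fun h => hx (h ▸ hyS)) hy
    · dsimp only
      rw [Finset.insert_erase hxB, Finset.insert_erase hB]
  · rintro ⟨B, P⟩ h
    rw [Finset.mem_sigma, Finset.mem_powerset] at h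
    rw [Finset.prod_insert (insert_mem_partitions hx h.1 h.2).2]

/-- The exponential formula. -/
theorem sum_partitions_eq_expCoeff {a : ℕ → K} (ha : a 0 = 0) (S : Finset α) :
    ∑ P ∈ partitions S, ∏ B ∈ P, a B.card = expCoeff a S.card := by
  induction hn : S.card using Nat.strong_induction_on generalizing S with
  | _ n ih =>
    rcases S.eq_empty_or_nonempty with rfl | ⟨x, hx⟩
    · subst hn
      rw [partitions_empty, Finset.card_empty, expCoeff_zero ha]
      simp
    · obtain ⟨S, hxS, rfl⟩ : ∃ S', x ∉ S' ∧ S = insert x S' :=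
        ⟨S.erase x, Finset.notMem_erase _ _, (Finset.insert_erase hx).symm⟩
      rw [Finset.card_insert_of_notMem hxS] at hn
      subst hn
      rw [sum_partitions_insert hxS, expCoeff_succ ha]
      have : ∀ B ∈ S.powerset,
          a (insert x B).card * ∑ P ∈ partitions (S \ B), ∏ C ∈ P, a C.card =
            (fun k => a (k + 1) * expCoeff a (S.card - k)) B.card := by
        intro B hB
        rw [Finset.mem_powerset] at hB
        dsimp only
        rw [Finset.card_insert_of_notMem fun h => hxS (hB h),
          ih (S \ B).card ?_ _ rfl, Finset.card_sdiff_of_subset hB]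
        rw [Nat.lt_succ_iff]
        exact Finset.card_le_card Finset.sdiff_subset
      rw [Finset.sum_congr rfl this,
        Finset.sum_powerset_apply_card (fun k => a (k + 1) * expCoeff a (S.card - k))]
      simp only [nsmul_eq_mul]

end Partitions

/-! ### Sums over the subsets of a disjoint union -/

section Powerset

variable {ι κ R : Type} [DecidableEq ι] [DecidableEq κ] [CommSemiring R]

theorem sum_powerset_union {A B : Finset ι} (h : Disjoint A B) (f g : Finset ι → R) :
    ∑ F ∈ (A ∪ B).powerset, f (F ∩ A) * g (F ∩ B) =
      (∑ F ∈ A.powerset, f F) * ∑ F ∈ B.powerset, g F := by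
  rw [Finset.sum_mul_sum, ← Finset.sum_product']
  refine Finset.sum_bij' (fun F _ => (F ∩ A, F ∩ B)) (fun p _ => p.1 ∪ p.2) ?_ ?_ ?_ ?_ ?_
  · intro F _
    simp
  · rintro ⟨F, G⟩ hp
    simp only [Finset.mem_product, Finset.mem_powerset] at hp ⊢
    exact Finset.union_subset_union hp.1 hp.2
  · intro F hF
    rw [Finset.mem_powerset] at hF
    dsimp only
    rw [← Finset.inter_union_distrib_left, Finset.inter_eq_left.mpr hF]
  · rintro ⟨F, G⟩ hp
    simp only [Finset.mem_product, Finset.mem_powerset] at hp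
    have h1 : G ∩ A = ∅ :=
      Finset.disjoint_iff_inter_eq_empty.mp (h.symm.mono_left hp.2)
    have h2 : F ∩ B = ∅ := Finset.disjoint_iff_inter_eq_empty.mp (h.mono_left hp.1)
    simp only [Finset.union_inter_distrib_right, h1, h2, Finset.inter_eq_left.mpr hp.1,
      Finset.inter_eq_left.mpr hp.2, Finset.union_empty, Finset.empty_union]
  · intro F _
    rfl

theorem sum_powerset_biUnion {X : Finset κ} {c : κ → Finset ι}
    (h : (X : Set κ).PairwiseDisjoint c) (f : κ → Finset ι → R) :
    ∑ F ∈ (X.biUnion c).powerset, ∏ C ∈ X, f C (F ∩ c C) =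
      ∏ C ∈ X, ∑ F ∈ (c C).powerset, f C F := by
  induction X using Finset.induction_on with
  | empty => simp
  | insert C X hC ih =>
    rw [Finset.coe_insert, Set.pairwiseDisjoint_insert_of_notMem (by simpa using hC)] at h
    rw [Finset.prod_insert hC, ← ih h.1, Finset.biUnion_insert,
      ← sum_powerset_union ((Finset.disjoint_biUnion_right _ _ _).mpr fun D hD => h.2 D hD)]
    refine Finset.sum_congr rfl fun F _ => ?_
    rw [Finset.prod_insert hC]
    congr 1
    refine Finset.prod_congr rfl fun D hD => ?_
    rw [Finset.inter_assoc, Finset.inter_eq_right.mpr (Finset.subset_biUnion_of_mem c hD)]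

end Powerset

/-! ### Independent subsets for an involution -/

section Involution

variable {α R : Type} [DecidableEq α] [CommSemiring R]

/-- The involution has no fixed point on `I`, so `I` is a union of two-element orbits. An
independent set takes nothing or one of the two points in each orbit, whence a factor `1 + 2 * y`
per orbit. The induction removes one orbit at a time. -/
theorem sum_independent {σ : α → α} (hσ : Function.Involutive σ) {I : Finset α}
    (hI : ∀ a ∈ I, σ a ∈ I) (hne : ∀ a ∈ I, σ a ≠ a) (y : R) :
    ∑ Z ∈ I.powerset with ∀ a ∈ Z, σ a ∉ Z, y ^ Z.card =
      (1 + 2 * y) ^ (I.image fun a => s(a, σ a)).card := by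
  induction hn : I.card using Nat.strong_induction_on generalizing I with
  | _ n ih =>
    rcases I.eq_empty_or_nonempty with rfl | ⟨a, ha⟩
    · simp [Finset.filter_singleton]
    · have hb := hI a ha
      have hab := hne a ha
      set J := (I.erase a).erase (σ a) with hJ
      have haJ : a ∉ J := fun h => Finset.notMem_erase _ _ (Finset.mem_of_mem_erase h)
      have hbJ : σ a ∉ J := Finset.notMem_erase _ _
      have hIJ : I = insert a (insert (σ a) J) := by
        rw [hJ, Finset.insert_erase (Finset.mem_erase.mpr ⟨hab, hb⟩), Finset.insert_erase ha]
      have habJ : a ∉ insert (σ a) J := by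
        rw [Finset.mem_insert, not_or]
        exact ⟨hab.symm, haJ⟩
      have hmem : ∀ c, c ∈ J ↔ c ≠ σ a ∧ c ≠ a ∧ c ∈ I := fun c => by
        rw [hJ, Finset.mem_erase, Finset.mem_erase]
      have hσJ : ∀ c ∈ J, σ c ∈ J := fun c hc => by
        rw [hmem] at hc ⊢
        refine ⟨fun h => hc.2.1 (hσ.injective h), fun h => hc.1 ?_, hI c hc.2.2⟩
        rw [← h, hσ]
      have hcard : J.card < n := by
        rw [← hn, hIJ, Finset.card_insert_of_notMem habJ, Finset.card_insert_of_notMem hbJ]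
        omega
      have hIH := ih J.card hcard hσJ (fun c hc => hne c ((hmem c).mp hc).2.2) rfl
      have himg : (I.image fun c => s(c, σ c)) =
          insert s(a, σ a) (J.image fun c => s(c, σ c)) := by
        rw [hIJ, Finset.image_insert, Finset.image_insert, hσ, Sym2.eq_swap,
          Finset.insert_idem]
      have hnot : s(a, σ a) ∉ J.image fun c => s(c, σ c) := by
        rw [Finset.mem_image]
        rintro ⟨c, hc, h⟩
        rw [Sym2.eq_iff] at h
        rcases h with ⟨rfl, -⟩ | ⟨rfl, -⟩
        · exact haJ hc
        · exact hbJ hc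
      rw [himg, Finset.card_insert_of_notMem hnot, pow_succ, ← hIH, hIJ]
      rw [Finset.sum_filter, Finset.sum_filter,
        Finset.sum_powerset_insert habJ, Finset.sum_powerset_insert hbJ,
        Finset.sum_powerset_insert hbJ]
      have hsub : ∀ {Z : Finset α}, Z ∈ J.powerset → a ∉ Z ∧ σ a ∉ Z ∧ ∀ c ∈ Z, σ c ≠ a ∧
          σ c ≠ σ a := fun {Z} hZ => by
        rw [Finset.mem_powerset] at hZ
        refine ⟨fun h => haJ (hZ h), fun h => hbJ (hZ h), fun c hc => ⟨fun h => haJ ?_,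
          fun h => haJ ?_⟩⟩
        · exact h ▸ hσJ c (hZ hc)
        · exact hσ.injective h ▸ hZ hc
      have e1 : ∀ Z ∈ J.powerset,
          (if ∀ c ∈ insert (σ a) Z, σ c ∉ insert (σ a) Z then y ^ (insert (σ a) Z).card else 0) =
            y * if ∀ c ∈ Z, σ c ∉ Z then y ^ Z.card else 0 := by
        intro Z hZ
        obtain ⟨h1, h2, h3⟩ := hsub hZ
        rw [Finset.card_insert_of_notMem h2, pow_succ', mul_ite, mul_zero]
        refine if_congr ?_ rfl rfl
        constructor
        · intro h c hc hc'
          exact h c (Finset.mem_insert_of_mem hc) (Finset.mem_insert_of_mem hc')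
        · intro h c hc hc'
          rcases Finset.mem_insert.mp hc with rfl | hc
          · rw [hσ] at hc'
            rcases Finset.mem_insert.mp hc' with hc' | hc'
            · exact hab hc'.symm
            · exact h1 hc'
          · rcases Finset.mem_insert.mp hc' with hc' | hc'
            · exact (h3 c hc).2 hc'
            · exact h c hc hc'
      have e2 : ∀ Z ∈ J.powerset,
          (if ∀ c ∈ insert a Z, σ c ∉ insert a Z then y ^ (insert a Z).card else 0) =
            y * if ∀ c ∈ Z, σ c ∉ Z then y ^ Z.card else 0 := by
        intro Z hZ
        obtain ⟨h1, h2, h3⟩ := hsub hZ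
        rw [Finset.card_insert_of_notMem h1, pow_succ', mul_ite, mul_zero]
        refine if_congr ?_ rfl rfl
        constructor
        · intro h c hc hc'
          exact h c (Finset.mem_insert_of_mem hc) (Finset.mem_insert_of_mem hc')
        · intro h c hc hc'
          rcases Finset.mem_insert.mp hc with rfl | hc
          · rcases Finset.mem_insert.mp hc' with hc' | hc'
            · exact hab hc'
            · exact h2 hc'
          · rcases Finset.mem_insert.mp hc' with hc' | hc'
            · exact (h3 c hc).1 hc'
            · exact h c hc hc'
      have e3 : ∀ Z ∈ J.powerset,
          (if ∀ c ∈ insert a (insert (σ a) Z), σ c ∉ insert a (insert (σ a) Z) then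
            y ^ (insert a (insert (σ a) Z)).card else 0) = 0 := by
        intro Z _
        rw [if_neg]
        intro h
        exact h a (Finset.mem_insert_self _ _)
          (Finset.mem_insert_of_mem (Finset.mem_insert_self _ _))
      rw [Finset.sum_congr rfl e1, Finset.sum_congr rfl e2, Finset.sum_congr rfl e3,
        ← Finset.mul_sum, Finset.sum_const_zero]
      ring

/-- Points of `S \ I` are unconstrained, since `σ` sends them out of `S`; each contributes `1 + t`.
Inside `I`, the two chosen sets together form an independent set whose points are coloured with
weight `t` or `ρ`, so `sum_independent` applies with `y = t + ρ`. Later `S` is the family of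
source-like ordinary components, `I` the isolated ones, and `σ` negation. -/
theorem sum_independent_pairs {σ : α → α} (hσ : Function.Involutive σ) {S I : Finset α}
    (hIS : I ⊆ S) (hI : ∀ a ∈ S, σ a ∈ S ↔ a ∈ I) (hne : ∀ a ∈ I, σ a ≠ a) (t ρ : R) :
    ∑ p ∈ S.powerset ×ˢ I.powerset with
        Disjoint p.1 p.2 ∧ ∀ a ∈ p.1 ∪ p.2, σ a ∉ p.1 ∪ p.2,
      t ^ p.1.card * ρ ^ p.2.card =
      (1 + t) ^ (S \ I).card * (1 + 2 * (t + ρ)) ^ (I.image fun a => s(a, σ a)).card := by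
  have hII : ∀ a ∈ I, σ a ∈ I := fun a ha => by
    rw [← hI _ ((hI a (hIS ha)).mpr ha), hσ]
    exact hIS ha
  have e1 : (1 + t) ^ (S \ I).card = ∑ Y ∈ (S \ I).powerset, t ^ Y.card := by
    rw [← Finset.prod_const, Finset.prod_one_add]
    simp
  have e2 : ∀ Z ∈ I.powerset.filter (fun Z => ∀ a ∈ Z, σ a ∉ Z),
      (t + ρ) ^ Z.card = ∑ Q ∈ Z.powerset, t ^ (Z \ Q).card * ρ ^ Q.card := by
    intro Z _
    rw [add_comm t, ← Finset.sum_pow_mul_eq_add_pow]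
    refine Finset.sum_congr rfl fun Q hQ => ?_
    rw [Finset.card_sdiff_of_subset (Finset.mem_powerset.mp hQ), mul_comm]
  rw [← sum_independent hσ hII hne, e1, Finset.sum_congr rfl e2, Finset.sum_mul_sum]
  simp only [Finset.mul_sum]
  simp_rw [Finset.sum_sigma']
  -- The triple records the unconstrained points, the independent set inside `I`, and its points of
  -- colour `ρ`.
  refine Finset.sum_bij' (fun p _ => ⟨p.1 \ I, (p.1 ∩ I) ∪ p.2, p.2⟩)
    (fun q _ => (q.1 ∪ (q.2.1 \ q.2.2), q.2.2)) ?_ ?_ ?_ ?_ ?_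
  · rintro ⟨T, Q⟩ hp
    simp only [Finset.mem_filter, Finset.mem_product, Finset.mem_powerset] at hp
    obtain ⟨⟨hT, hQ⟩, hd, hc⟩ := hp
    simp only [Finset.mem_sigma, Finset.mem_filter, Finset.mem_powerset]
    refine ⟨Finset.sdiff_subset_sdiff hT subset_rfl,
      ⟨Finset.union_subset Finset.inter_subset_right hQ, fun a ha ha' => ?_⟩,
      Finset.subset_union_right⟩
    have hsub : T ∩ I ∪ Q ⊆ T ∪ Q := Finset.union_subset_union Finset.inter_subset_left subset_rfl
    exact hc a (hsub ha) (hsub ha')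
  · rintro ⟨Y, Z, Q⟩ hq
    simp only [Finset.mem_sigma, Finset.mem_filter, Finset.mem_powerset] at hq
    obtain ⟨hY, ⟨hZ, hc⟩, hQ⟩ := hq
    simp only [Finset.mem_filter, Finset.mem_product, Finset.mem_powerset]
    have hYI : ∀ a ∈ Y, a ∈ S ∧ a ∉ I := fun a ha => Finset.mem_sdiff.mp (hY ha)
    refine ⟨⟨Finset.union_subset (hY.trans Finset.sdiff_subset)
      ((Finset.sdiff_subset.trans hZ).trans hIS), hQ.trans hZ⟩, ?_, ?_⟩
    · rw [Finset.disjoint_union_left]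
      refine ⟨?_, Finset.sdiff_disjoint⟩
      rw [Finset.disjoint_left]
      exact fun a ha ha' => (hYI a ha).2 (hZ (hQ ha'))
    · have : Y ∪ Z \ Q ∪ Q = Y ∪ Z := by
        rw [Finset.union_assoc, Finset.sdiff_union_of_subset hQ]
      rw [this]
      intro a ha ha'
      rcases Finset.mem_union.mp ha with ha | ha
      · have haS := (hYI a ha).1
        have : σ a ∈ S := by
          rcases Finset.mem_union.mp ha' with ha' | ha'
          · exact (hYI _ ha').1
          · exact hIS (hZ ha')
        exact (hYI a ha).2 ((hI a haS).mp this)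
      · rcases Finset.mem_union.mp ha' with ha' | ha'
        · exact (hYI _ ha').2 (hII a (hZ ha))
        · exact hc a ha ha'
  · rintro ⟨T, Q⟩ hp
    simp only [Finset.mem_filter, Finset.mem_product, Finset.mem_powerset] at hp
    obtain ⟨⟨hT, hQ⟩, hd, hc⟩ := hp
    ext1
    · ext a
      have := @Finset.disjoint_left _ T Q
      have h2 := this.mp hd
      have h3 := @h2 a
      simp only [Finset.mem_union, Finset.mem_sdiff, Finset.mem_inter]
      tauto
    · rfl
  · rintro ⟨Y, Z, Q⟩ hq
    simp only [Finset.mem_sigma, Finset.mem_filter, Finset.mem_powerset] at hq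
    obtain ⟨hY, ⟨hZ, hc⟩, hQ⟩ := hq
    have hYI : ∀ a ∈ Y, a ∈ S ∧ a ∉ I := fun a ha => Finset.mem_sdiff.mp (hY ha)
    have h1 : (Y ∪ Z \ Q) \ I = Y := by
      ext a
      have h1 := hYI a
      have h2 := @hZ a
      simp only [Finset.mem_union, Finset.mem_sdiff]
      tauto
    have h2 : (Y ∪ Z \ Q) ∩ I ∪ Q = Z := by
      ext a
      have h1 := hYI a
      have h2 := @hZ a
      have h3 := @hQ a
      simp only [Finset.mem_union, Finset.mem_sdiff, Finset.mem_inter]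
      tauto
    dsimp only
    rw [h1, h2]
  · rintro ⟨T, Q⟩ hp
    simp only [Finset.mem_filter, Finset.mem_product, Finset.mem_powerset] at hp
    obtain ⟨⟨hT, hQ⟩, hd, hc⟩ := hp
    dsimp only
    have h1 : (T ∩ I ∪ Q) \ Q = T ∩ I := by
      rw [Finset.union_sdiff_right]
      exact Finset.sdiff_eq_self_of_disjoint (hd.mono_left Finset.inter_subset_left)
    rw [h1, ← mul_assoc, ← pow_add, Finset.card_sdiff_add_card_inter]

end Involution

/-! ### Reachability and components -/

section Digraph

variable {V : Type} {G : Digraph V} {C : Set V}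

theorem isSCC_iff : IsSCC G C ↔ C.Nonempty ∧ (∀ x ∈ C, ∀ y ∈ C, Reach G x y) ∧
    ∀ x ∈ C, ∀ y, Reach G x y → Reach G y x → y ∈ C := by
  constructor
  · rintro ⟨hne, hC, hmax⟩
    refine ⟨hne, hC, fun x hx y hxy hyx => ?_⟩
    -- Maximality is tested on `C` with the single vertex `y` added.
    have h : ∀ a ∈ insert y C, ∀ b ∈ insert y C, Reach G a b := by
      rintro a (rfl | ha) b (rfl | hb)
      · exact Relation.ReflTransGen.refl
      · exact hyx.trans (hC x hx b hb)
      · exact (hC a ha x hx).trans hxy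
      · exact hC a ha b hb
    exact hmax h (Set.subset_insert y C) (Set.mem_insert y C)
  · rintro ⟨⟨x, hx⟩, hC, hmax⟩
    refine ⟨⟨x, hx⟩, hC, fun S hS hCS y hy => ?_⟩
    exact hmax x hx y (hS x (hCS hx) y hy) (hS y hy x (hCS hx))

theorem IsSCC.eq_of_mem {C' : Set V} (h : IsSCC G C) (h' : IsSCC G C') {x : V}
    (hx : x ∈ C) (hx' : x ∈ C') : C = C' := by
  rw [isSCC_iff] at h h'
  ext y
  exact ⟨fun hy => h'.2.2 x hx' y (h.2.1 x hx y hy) (h.2.1 y hy x hx),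
    fun hy => h.2.2 x hx y (h'.2.1 x hx' y hy) (h'.2.1 y hy x hx')⟩

theorem isSCC_component (x : V) : IsSCC G {y | Reach G x y ∧ Reach G y x} := by
  rw [isSCC_iff]
  exact ⟨⟨x, Relation.ReflTransGen.refl, Relation.ReflTransGen.refl⟩,
    fun y hy z hz => hy.2.trans hz.1,
    fun y hy z hyz hzy => ⟨hy.1.trans hyz, hzy.trans hy.2⟩⟩

theorem SourceLike.mem_of_reach (h : SourceLike G C) {x y : V} (hxy : Reach G x y)
    (hy : y ∈ C) : x ∈ C := by
  induction hxy using Relation.ReflTransGen.head_induction_on with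
  | refl => exact hy
  | head hab _ ih =>
    by_contra hx
    exact h _ hx _ ih hab

theorem SinkLike.mem_of_reach (h : SinkLike G C) {x y : V} (hxy : Reach G x y)
    (hx : x ∈ C) : y ∈ C := by
  induction hxy with
  | refl => exact hx
  | tail _ hbc ih =>
    by_contra hy
    exact h _ ih _ hy hbc

theorem SourceLike.isSCC (h : SourceLike G C) (hne : C.Nonempty)
    (hC : ∀ x ∈ C, ∀ y ∈ C, Reach G x y) : IsSCC G C :=
  isSCC_iff.mpr ⟨hne, hC, fun _ hx _ _ hyx => h.mem_of_reach hyx hx⟩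

/-- In a finite digraph, every vertex is reached from a source-like component. -/
theorem exists_sourceLike_reach [Finite V] (y : V) :
    ∃ C, IsSCC G C ∧ SourceLike G C ∧ ∃ x ∈ C, Reach G x y := by
  -- Among the vertices that reach `y`, take `x` with a minimal set of predecessors. A vertex `a`
  -- with an arc into the component of `x` has no more predecessors than `x`, so by minimality `x`
  -- reaches `a`, and `a` was already in the component.
  obtain ⟨x, hxy, hmin⟩ := (Set.toFinite {x | Reach G x y}).exists_minimalFor
    (fun x => {z | Reach G z x}) _ ⟨y, Relation.ReflTransGen.refl⟩
  refine ⟨{z | Reach G x z ∧ Reach G z x}, isSCC_component x, ?_, x,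
    ⟨Relation.ReflTransGen.refl, Relation.ReflTransGen.refl⟩, hxy⟩
  rintro a ha b ⟨hxb, hbx⟩ hab
  have hax : Reach G a x := Relation.ReflTransGen.head hab hbx
  have := hmin (j := a) (hax.trans hxy) (fun z hz => hz.trans hax)
  exact ha ⟨this Relation.ReflTransGen.refl, hax⟩

theorem ncard_setOf_eq_card [Fintype V] (p : Set V → Prop) [DecidablePred p] :
    {C : Set V | p C}.ncard = (Finset.univ.filter fun C : Finset V => p C).card := by
  classical
  rw [← Set.ncard_coe_finset, ← Set.ncard_image_of_injective _ Finset.coe_injective]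
  congr 1
  ext C
  simp only [Set.mem_ofPred_eq, Finset.coe_filter, Finset.mem_univ, true_and, Set.mem_image]
  constructor
  · intro h
    exact ⟨C.toFinset, by simpa using h, by simp⟩
  · rintro ⟨C, h, rfl⟩
    exact h

end Digraph

/-! ### Negation -/

section Literals

variable {n : ℕ} {F : Finset (Sym2 (Literal n))}

@[simp]
theorem neg_neg' (x : Literal n) : neg (neg x) = x := by
  simp [neg]

theorem neg_involutive : Function.Involutive (neg : Literal n → Literal n) := neg_neg'

@[simp]
theorem neg_fst (x : Literal n) : (neg x).1 = x.1 := rfl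

theorem neg_ne (x : Literal n) : neg x ≠ x := by
  intro h
  have := congrArg Prod.snd h
  simp [neg] at this

theorem eq_or_eq_neg {x y : Literal n} (h : x.1 = y.1) : x = y ∨ x = neg y := by
  obtain ⟨i, a⟩ := x
  obtain ⟨j, b⟩ := y
  dsimp only at h
  subst h
  cases a <;> cases b <;> simp [neg]

theorem mem_clauses {a b : Literal n} : s(a, b) ∈ clauses n ↔ a.1 ≠ b.1 := by
  simp [clauses]

theorem implicationDigraph_adj {x y : Literal n} :
    (implicationDigraph F).Adj x y ↔ s(neg x, y) ∈ F := Iff.rfl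

theorem adj_neg {x y : Literal n} :
    (implicationDigraph F).Adj (neg y) (neg x) ↔ (implicationDigraph F).Adj x y := by
  rw [implicationDigraph_adj, implicationDigraph_adj, neg_neg', Sym2.eq_swap]

/-- Skew symmetry: the contrapositives of the arcs of a path, taken in reverse order, form a path.
-/
theorem reach_neg {x y : Literal n} (h : Reach (implicationDigraph F) x y) :
    Reach (implicationDigraph F) (neg y) (neg x) := by
  induction h with
  | refl => exact Relation.ReflTransGen.refl
  | tail _ hbc ih => exact Relation.ReflTransGen.head (adj_neg.mpr hbc) ih

theorem reach_mono {F' : Finset (Sym2 (Literal n))} (h : F' ⊆ F) {x y : Literal n}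
    (hxy : Reach (implicationDigraph F') x y) : Reach (implicationDigraph F) x y :=
  Relation.ReflTransGen.mono (fun _ _ hab => h hab) _ _ hxy

theorem contradictoryVar_iff (x : Literal n) :
    ContradictoryVar (implicationDigraph F) x.1 ↔
      Reach (implicationDigraph F) x (neg x) ∧ Reach (implicationDigraph F) (neg x) x := by
  obtain ⟨i, b⟩ := x
  cases b
  · exact and_comm
  · exact Iff.rfl

theorem mem_image_neg {C : Set (Literal n)} {x : Literal n} : x ∈ neg '' C ↔ neg x ∈ C := by
  constructor
  · rintro ⟨y, hy, rfl⟩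
    rwa [neg_neg']
  · intro h
    exact ⟨neg x, h, neg_neg' x⟩

theorem isContradictorySCC_iff {C : Set (Literal n)} :
    IsContradictorySCC (implicationDigraph F) C ↔
      IsSCC (implicationDigraph F) C ∧ ∃ x ∈ C, neg x ∈ C := by
  refine and_congr_right fun h => ?_
  constructor
  · rintro ⟨x, hx, hc⟩
    rw [contradictoryVar_iff] at hc
    exact ⟨x, hx, (isSCC_iff.mp h).2.2 x hx _ hc.1 hc.2⟩
  · rintro ⟨x, hx, hc⟩
    refine ⟨x, hx, ?_⟩
    rw [contradictoryVar_iff]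
    exact ⟨(isSCC_iff.mp h).2.1 x hx _ hc, (isSCC_iff.mp h).2.1 _ hc x hx⟩

theorem isOrdinarySCC_iff {C : Set (Literal n)} :
    IsOrdinarySCC (implicationDigraph F) C ↔
      IsSCC (implicationDigraph F) C ∧ ∀ x ∈ C, neg x ∉ C := by
  rw [IsOrdinarySCC, isContradictorySCC_iff]
  refine and_congr_right fun h => ?_
  rw [not_and]
  push Not
  exact ⟨fun h' => h' h, fun h' _ => h'⟩

theorem IsSCC.image_neg {C : Set (Literal n)} (h : IsSCC (implicationDigraph F) C) :
    IsSCC (implicationDigraph F) (neg '' C) := by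
  rw [isSCC_iff] at h ⊢
  obtain ⟨hne, hC, hmax⟩ := h
  refine ⟨hne.image _, ?_, ?_⟩
  · rintro _ ⟨x, hx, rfl⟩ _ ⟨y, hy, rfl⟩
    exact reach_neg (hC y hy x hx)
  · rintro _ ⟨x, hx, rfl⟩ y hxy hyx
    rw [mem_image_neg]
    refine hmax x hx _ ?_ ?_
    · simpa using reach_neg hyx
    · simpa using reach_neg hxy

theorem IsOrdinarySCC.image_neg {C : Set (Literal n)}
    (h : IsOrdinarySCC (implicationDigraph F) C) :
    IsOrdinarySCC (implicationDigraph F) (neg '' C) := by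
  rw [isOrdinarySCC_iff] at h ⊢
  refine ⟨h.1.image_neg, fun x hx hx' => ?_⟩
  rw [mem_image_neg] at hx hx'
  exact h.2 _ hx hx'

/-- Contradictory components are closed under negation. -/
theorem IsContradictorySCC.neg_mem {C : Set (Literal n)}
    (h : IsContradictorySCC (implicationDigraph F) C) {x : Literal n} (hx : x ∈ C) :
    neg x ∈ C := by
  rw [isContradictorySCC_iff] at h
  obtain ⟨hC, y, hy, hy'⟩ := h
  have : C = neg '' C := hC.eq_of_mem hC.image_neg hy (mem_image_neg.mpr hy')
  rw [this, mem_image_neg, neg_neg']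
  exact hx

theorem sourceLike_image_neg {C : Set (Literal n)} :
    SourceLike (implicationDigraph F) (neg '' C) ↔ SinkLike (implicationDigraph F) C := by
  constructor
  · intro h x hx y hy hxy
    refine h (neg y) ?_ (neg x) ?_ (adj_neg.mpr hxy)
    · rwa [mem_image_neg, neg_neg']
    · rwa [mem_image_neg, neg_neg']
  · intro h x hx y hy hxy
    rw [mem_image_neg] at hx hy
    exact h (neg y) hy (neg x) hx (adj_neg.mpr hxy)

/-- The set of literals has no two opposite literals. -/
def Consistent (L : Finset (Literal n)) : Prop := ∀ x ∈ L, neg x ∉ L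

/-- Any two literals of `C` are joined by paths in both directions. -/
def Conn (F : Finset (Sym2 (Literal n))) (C : Finset (Literal n)) : Prop :=
  ∀ x ∈ C, ∀ y ∈ C, Reach (implicationDigraph F) x y

/-- The clauses whose arcs join two literals of `C`, or the negations of two such literals. -/
def innerClauses (C : Finset (Literal n)) : Finset (Sym2 (Literal n)) :=
  C.offDiag.image fun p => s(neg p.1, p.2)

/-- The clauses on a set of variables. -/
def clausesOn (R : Finset (Fin n)) : Finset (Sym2 (Literal n)) :=
  (clauses n).filter fun c => ∀ a ∈ c, a.1 ∈ R

theorem mem_innerClauses {C : Finset (Literal n)} {x y : Literal n} (hx : x ∈ C) (hy : y ∈ C)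
    (hxy : x ≠ y) : s(neg x, y) ∈ innerClauses C :=
  Finset.mem_image.mpr ⟨(x, y), Finset.mem_offDiag.mpr ⟨hx, hy, hxy⟩, rfl⟩

theorem mem_clausesOn {R : Finset (Fin n)} {a b : Literal n} :
    s(a, b) ∈ clausesOn R ↔ a.1 ≠ b.1 ∧ a.1 ∈ R ∧ b.1 ∈ R := by
  rw [clausesOn, Finset.mem_filter, mem_clauses]
  simp

/-- A path ending in a source-like set lies entirely in it, so only arcs inside `C` are used. -/
theorem conn_inter_innerClauses {C : Finset (Literal n)}
    (hC : SourceLike (implicationDigraph F) C) (h : Conn F C) :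
    Conn (F ∩ innerClauses C) C := by
  intro x _ y hy
  have hxy := h x ‹_› y hy
  induction hxy using Relation.ReflTransGen.head_induction_on with
  | refl => exact Relation.ReflTransGen.refl
  | @head a b hab hby ih =>
    have hb : b ∈ C := by
      have := hC.mem_of_reach hby hy
      exact this
    have hbr := ih hb
    -- `F` is not assumed to consist of 2-clauses here, so loops are possible; they can be dropped
    -- from a path.
    by_cases hne : a = b
    · rw [hne]
      exact hbr
    · exact Relation.ReflTransGen.head
        (Finset.mem_inter.mpr ⟨hab, mem_innerClauses ‹_› hb hne⟩) hbr

theorem conn_inter_iff {C : Finset (Literal n)} (hC : SourceLike (implicationDigraph F) C) :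
    Conn (F ∩ innerClauses C) C ↔ Conn F C :=
  ⟨fun h x hx y hy => reach_mono Finset.inter_subset_left (h x hx y hy),
    conn_inter_innerClauses hC⟩

theorem isOrdinarySCC_iff_of_sourceLike {C : Finset (Literal n)}
    (hC : SourceLike (implicationDigraph F) C) :
    IsOrdinarySCC (implicationDigraph F) C ↔ C.Nonempty ∧ Consistent C ∧ Conn F C := by
  rw [isOrdinarySCC_iff]
  constructor
  · rintro ⟨h, hc⟩
    rw [isSCC_iff] at h
    exact ⟨h.1, hc, h.2.1⟩
  · rintro ⟨hne, hc, h⟩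
    exact ⟨hC.isSCC hne h, hc⟩

/-! ### Contradictory components outside a source-like set -/

theorem fst_mem_compl_image_fst {L : Finset (Literal n)} {x : Literal n} :
    x.1 ∈ Finset.univ \ L.image Prod.fst ↔ x ∉ L ∧ neg x ∉ L := by
  rw [Finset.mem_sdiff, and_iff_right (Finset.mem_univ _), Finset.mem_image]
  constructor
  · intro h
    exact ⟨fun hx => h ⟨x, hx, rfl⟩, fun hx => h ⟨_, hx, rfl⟩⟩
  · rintro ⟨h1, h2⟩ ⟨y, hy, hyx⟩
    rcases eq_or_eq_neg hyx with rfl | rfl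
    · exact h1 hy
    · exact h2 hy

/-- A path between literals of variables outside `L` avoids those variables. It cannot enter `L`,
which is source-like; and if it met the negation of a literal of `L`, the contrapositive path would
enter `L` from the negation of its endpoint. -/
theorem reach_inter_clausesOn (hF : F ⊆ clauses n) {L : Finset (Literal n)}
    (hL : SourceLike (implicationDigraph F) L) {x y : Literal n}
    (hx : x.1 ∈ Finset.univ \ L.image Prod.fst) (hy : y.1 ∈ Finset.univ \ L.image Prod.fst)
    (h : Reach (implicationDigraph F) x y) :
    Reach (implicationDigraph (F ∩ clausesOn (Finset.univ \ L.image Prod.fst))) x y := by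
  induction h using Relation.ReflTransGen.head_induction_on with
  | refl => exact Relation.ReflTransGen.refl
  | @head a b hab hby ih =>
    have hb : b.1 ∈ Finset.univ \ L.image Prod.fst := by
      rw [fst_mem_compl_image_fst] at hx hy ⊢
      refine ⟨fun hb => hL _ hx.1 _ hb hab, fun hb => hy.2 ?_⟩
      exact hL.mem_of_reach (reach_neg hby) hb
    refine Relation.ReflTransGen.head (Finset.mem_inter.mpr ⟨hab, ?_⟩) (ih hb)
    rw [mem_clausesOn]
    exact ⟨mem_clauses.mp (hF hab), hx, hb⟩

/-- If a literal of `L` and its negation reached each other, both would lie in the source-like set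
`L`, against consistency. So contradictory components use only the remaining variables, and the
paths that define them survive the restriction. -/
theorem numContradictory_inter_clausesOn (hF : F ⊆ clauses n) {L : Finset (Literal n)}
    (hc : Consistent L) (hL : SourceLike (implicationDigraph F) L) :
    numContradictory (implicationDigraph (F ∩ clausesOn (Finset.univ \ L.image Prod.fst))) =
      numContradictory (implicationDigraph F) := by
  set R := Finset.univ \ L.image Prod.fst with hR
  have hsub : F ∩ clausesOn R ⊆ F := Finset.inter_subset_left
  have hmem : ∀ x : Literal n, Reach (implicationDigraph F) x (neg x) →
      Reach (implicationDigraph F) (neg x) x → x.1 ∈ R := by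
    intro x h1 h2
    rw [hR, fst_mem_compl_image_fst]
    exact ⟨fun hx => hc x hx (hL.mem_of_reach h2 hx),
      fun hx => hc _ (hL.mem_of_reach h1 hx) hx⟩
  unfold numContradictory
  congr 1
  ext C
  rw [Set.mem_ofPred_eq, Set.mem_ofPred_eq]
  constructor
  · rintro h
    obtain ⟨hS, x, hx, hx'⟩ := isContradictorySCC_iff.mp h
    have hSi := isSCC_iff.mp hS
    have hR' : ∀ y ∈ C, y.1 ∈ R := fun y hy =>
      hmem y (reach_mono hsub (hSi.2.1 _ hy _ (h.neg_mem hy)))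
        (reach_mono hsub (hSi.2.1 _ (h.neg_mem hy) _ hy))
    rw [isContradictorySCC_iff]
    refine ⟨isSCC_iff.mpr ⟨hSi.1, fun a ha b hb => reach_mono hsub (hSi.2.1 a ha b hb),
      fun a ha b hab hba => ?_⟩, x, hx, hx'⟩
    have haa := reach_mono hsub (hSi.2.1 _ ha _ (h.neg_mem ha))
    have haa' := reach_mono hsub (hSi.2.1 _ (h.neg_mem ha) _ ha)
    -- The variable of `b` is contradictory as well: from `b` to `a`, then to the negation of `a`,
    -- then to the negation of `b`, and back.
    have hb : b.1 ∈ R := hmem b ((hba.trans haa).trans (reach_neg hba))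
      ((reach_neg hab).trans (haa'.trans hab))
    exact hSi.2.2 a ha b (reach_inter_clausesOn hF hL (hR' a ha) hb hab)
      (reach_inter_clausesOn hF hL hb (hR' a ha) hba)
  · rintro h
    obtain ⟨hS, x, hx, hx'⟩ := isContradictorySCC_iff.mp h
    have hSi := isSCC_iff.mp hS
    have hR' : ∀ y ∈ C, y.1 ∈ R := fun y hy =>
      hmem y (hSi.2.1 _ hy _ (h.neg_mem hy)) (hSi.2.1 _ (h.neg_mem hy) _ hy)
    rw [isContradictorySCC_iff]
    refine ⟨isSCC_iff.mpr ⟨hSi.1, fun a ha b hb =>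
      reach_inter_clausesOn hF hL (hR' a ha) (hR' b hb) (hSi.2.1 a ha b hb),
      fun a ha b hab hba => ?_⟩, x, hx, hx'⟩
    exact hSi.2.2 a ha b (reach_mono hsub hab) (reach_mono hsub hba)

end Literals

/-! ### Relabeling -/

section Relabel

theorem sum_powerset_image {ι κ R : Type} [DecidableEq κ] [AddCommMonoid R]
    {e : ι → κ} (he : Function.Injective e) (S : Finset ι) (g : Finset κ → R) :
    ∑ F ∈ (S.image e).powerset, g F = ∑ A ∈ S.powerset, g (A.image e) := by
  classical
  rw [Finset.powerset_image, Finset.sum_image fun _ _ _ _ h => Finset.image_injective he h]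

theorem Reach.map {V V' : Type} {G : Digraph V} {H : Digraph V'} {φ : V → V'}
    (h : ∀ x y, G.Adj x y → H.Adj (φ x) (φ y)) {x y : V} (hxy : Reach G x y) :
    Reach H (φ x) (φ y) :=
  Relation.ReflTransGen.lift φ h _ _ hxy

theorem Reach.exists_of_map {V V' : Type} {G : Digraph V} {H : Digraph V'} {φ : V → V'}
    (h : ∀ x y', H.Adj (φ x) y' → ∃ y, φ y = y' ∧ G.Adj x y) {x : V} {y' : V'}
    (hxy : Reach H (φ x) y') : ∃ y, φ y = y' ∧ Reach G x y := by
  induction hxy with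
  | refl => exact ⟨x, rfl, Relation.ReflTransGen.refl⟩
  | tail _ hbc ih =>
    obtain ⟨b, rfl, hb⟩ := ih
    obtain ⟨c, rfl, hc⟩ := h b _ hbc
    exact ⟨c, rfl, hb.tail hc⟩

theorem stronglyConnected_iff {V : Type} {G : Digraph V} :
    StronglyConnected G ↔ Nonempty V ∧ ∀ x y, Reach G x y := by
  rw [StronglyConnected, isSCC_iff, ← Set.nonempty_iff_univ_nonempty]
  simp

end Relabel

/-! ### Weights of components depend only on the number of labels -/

section Components

variable {n : ℕ}

open Classical in
/-- The total weight of the strongly connected digraphs on `k` vertices. -/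
def sccCoeff (k : ℕ) : K :=
  ∑ A ∈ arcSets k with StronglyConnected (digraphOfArcs A), w ^ A.card

open Classical in
/-- The total weight of the contradictory components on `k` variables. -/
def csccCoeff (k : ℕ) : K :=
  ∑ F ∈ twoCNFs k with IsContradictorySCC (implicationDigraph F) Set.univ, w ^ F.card

theorem SCC_eq : SCC = egf sccCoeff := rfl

theorem CSCC_eq : CSCC = egf csccCoeff := rfl

theorem sccCoeff_zero : sccCoeff 0 = 0 := by
  refine Finset.sum_eq_zero fun A hA => ?_
  rw [@Finset.mem_filter _ _ (_), stronglyConnected_iff] at hA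
  exact (hA.2.1.elim fun i => i.elim0)

theorem csccCoeff_zero : csccCoeff 0 = 0 := by
  refine Finset.sum_eq_zero fun F hF => ?_
  rw [@Finset.mem_filter _ _ (_), isContradictorySCC_iff] at hF
  obtain ⟨-, -, x, -⟩ := hF
  exact x.1.elim0

/-- An arc between two literals of a consistent set is determined by its clause. -/
theorem arcClause_injective {k : ℕ} {C : Finset (Literal n)} (hC : Consistent C)
    {f : Fin k → Literal n} (hf : Function.Injective f) (hfC : ∀ i, f i ∈ C) :
    Function.Injective fun p : Fin k × Fin k => s(neg (f p.1), f p.2) := by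
  rintro ⟨i, j⟩ ⟨i', j'⟩ h
  rcases Sym2.eq_iff.mp h with ⟨h1, h2⟩ | ⟨h1, h2⟩
  · exact Prod.ext (hf (neg_involutive.injective h1)) (hf h2)
  -- The crossed identification would match an arc with the contrapositive of another one, which
  -- joins negations of literals of `C`.
  · exact absurd (h1 ▸ hfC j') (hC _ (hfC i))

theorem exists_parametrization {α : Type} (C : Finset α) :
    ∃ f : Fin C.card → α, Function.Injective f ∧ ∀ x, x ∈ C ↔ ∃ i, f i = x := by
  refine ⟨fun i => (C.equivFin.symm i : α),
    fun i j h => C.equivFin.symm.injective (Subtype.ext h), fun x => ⟨fun hx => ?_, ?_⟩⟩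
  · exact ⟨C.equivFin ⟨x, hx⟩, by simp⟩
  · rintro ⟨i, rfl⟩
    exact (C.equivFin.symm i).2

open Classical in
-- By consistency, clauses inside `C` correspond bijectively to non-loop arcs on `C`, and the
-- contrapositive arcs never start in `C`. Nonemptiness matters: for empty `C` connectivity is
-- vacuous and the sum is 1, while `sccCoeff 0 = 0`.
theorem sum_innerClauses {C : Finset (Literal n)} (hne : C.Nonempty) (hC : Consistent C) :
    ∑ F ∈ (innerClauses C).powerset, (if Conn F C then w ^ F.card else 0) =
      sccCoeff C.card := by
  obtain ⟨f, hf, hfC⟩ := exists_parametrization C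
  have hfm : ∀ i, f i ∈ C := fun i => (hfC _).mpr ⟨i, rfl⟩
  have he := arcClause_injective hC hf hfm
  have himg : innerClauses C = ((Finset.univ : Finset (Fin C.card)).offDiag).image
      fun p => s(neg (f p.1), f p.2) := by
    ext c
    simp only [innerClauses, Finset.mem_image, Finset.mem_offDiag]
    constructor
    · rintro ⟨⟨a, b⟩, ⟨ha, hb, hab⟩, rfl⟩
      dsimp only at ha hb hab
      obtain ⟨i, rfl⟩ := (hfC a).mp ha
      obtain ⟨j, rfl⟩ := (hfC b).mp hb
      exact ⟨(i, j), ⟨Finset.mem_univ _, Finset.mem_univ _, fun h => hab (congrArg f h)⟩, rfl⟩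
    · rintro ⟨⟨i, j⟩, ⟨-, -, hij⟩, rfl⟩
      exact ⟨(f i, f j), ⟨hfm i, hfm j, fun h => hij (hf h)⟩, rfl⟩
  rw [himg, sum_powerset_image he, sccCoeff, arcSets, Finset.sum_filter]
  refine Finset.sum_congr rfl fun A _ => ?_
  rw [Finset.card_image_of_injective _ he]
  refine if_congr ?_ rfl rfl
  rw [stronglyConnected_iff]
  have hadj : ∀ i j, (digraphOfArcs A).Adj i j →
      (implicationDigraph (A.image fun p => s(neg (f p.1), f p.2))).Adj (f i) (f j) :=
    fun i j hij => Finset.mem_image.mpr ⟨(i, j), hij, rfl⟩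
  have hadj' : ∀ i y,
      (implicationDigraph (A.image fun p => s(neg (f p.1), f p.2))).Adj (f i) y →
        ∃ j, f j = y ∧ (digraphOfArcs A).Adj i j := by
    intro i y hiy
    obtain ⟨⟨i', j'⟩, hA, h⟩ := Finset.mem_image.mp hiy
    rcases Sym2.eq_iff.mp h with ⟨h1, h2⟩ | ⟨h1, h2⟩
    · obtain rfl : i' = i := hf (neg_involutive.injective h1)
      exact ⟨j', h2, hA⟩
    · exact absurd (h2 ▸ hfm j') (hC _ (hfm i))
  constructor
  · intro h
    refine ⟨⟨⟨0, hne.card_pos⟩⟩, fun i j => ?_⟩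
    obtain ⟨j', hj, hr⟩ := (h _ (hfm i) _ (hfm j)).exists_of_map hadj'
    rwa [← hf hj]
  · rintro ⟨-, h⟩ x hx y hy
    obtain ⟨i, rfl⟩ := (hfC x).mp hx
    obtain ⟨j, rfl⟩ := (hfC y).mp hy
    exact (h i j).map hadj

/-! ### Relabeling of variables -/

/-- The map on literals that relabels the variables. -/
def relabel {m : ℕ} (f : Fin m → Fin n) (x : Literal m) : Literal n := (f x.1, x.2)

theorem relabel_neg {m : ℕ} (f : Fin m → Fin n) (x : Literal m) :
    relabel f (neg x) = neg (relabel f x) := rfl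

variable {m : ℕ} {f : Fin m → Fin n} {F : Finset (Sym2 (Literal m))}

theorem relabel_injective (hf : Function.Injective f) : Function.Injective (relabel f) := by
  rintro ⟨i, a⟩ ⟨j, b⟩ h
  rw [relabel, relabel, Prod.mk.injEq] at h
  exact Prod.ext (hf h.1) h.2

/-- The effect of a relabeling of the variables on a 2-CNF. -/
def relabelCNF (f : Fin m → Fin n) (F : Finset (Sym2 (Literal m))) :
    Finset (Sym2 (Literal n)) :=
  F.image (Sym2.map (relabel f))

theorem mem_relabelCNF {a b : Literal n} :
    s(a, b) ∈ relabelCNF f F ↔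
      ∃ a' b', s(a', b') ∈ F ∧ relabel f a' = a ∧ relabel f b' = b := by
  rw [relabelCNF, Finset.mem_image]
  constructor
  · rintro ⟨c, hc, h⟩
    induction c using Sym2.ind with
    | _ x y =>
      rw [Sym2.map_mk, Sym2.eq_iff] at h
      rcases h with ⟨h1, h2⟩ | ⟨h1, h2⟩
      · exact ⟨x, y, hc, h1, h2⟩
      · exact ⟨y, x, Sym2.eq_swap ▸ hc, h2, h1⟩
  · rintro ⟨a', b', h, rfl, rfl⟩
    exact ⟨_, h, Sym2.map_mk _ _ _⟩

theorem clausesOn_eq_image (hf : Function.Injective f) {R : Finset (Fin n)}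
    (hR : ∀ i, i ∈ R ↔ ∃ j, f j = i) :
    clausesOn R = (clauses m).image (Sym2.map (relabel f)) := by
  ext c
  induction c using Sym2.ind with
  | _ a b =>
    rw [← relabelCNF, mem_relabelCNF, mem_clausesOn]
    constructor
    · rintro ⟨hab, ha, hb⟩
      obtain ⟨i, hi⟩ := (hR _).mp ha
      obtain ⟨j, hj⟩ := (hR _).mp hb
      refine ⟨(i, a.2), (j, b.2), mem_clauses.mpr ?_, Prod.ext hi rfl, Prod.ext hj rfl⟩
      rintro rfl
      exact hab (hi.symm.trans hj)
    · rintro ⟨a, b, hab, rfl, rfl⟩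
      exact ⟨fun h => mem_clauses.mp hab (hf h), (hR _).mpr ⟨_, rfl⟩, (hR _).mpr ⟨_, rfl⟩⟩

theorem adj_relabel {x y : Literal m} (h : (implicationDigraph F).Adj x y) :
    (implicationDigraph (relabelCNF f F)).Adj (relabel f x) (relabel f y) :=
  mem_relabelCNF.mpr ⟨_, _, h, rfl, rfl⟩

theorem exists_adj_of_adj_relabel (hf : Function.Injective f) (x : Literal m) (y' : Literal n)
    (h : (implicationDigraph (relabelCNF f F)).Adj (relabel f x) y') :
    ∃ y, relabel f y = y' ∧ (implicationDigraph F).Adj x y := by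
  obtain ⟨a, b, hab, h1, h2⟩ := mem_relabelCNF.mp h
  rw [← relabel_neg] at h1
  rw [relabel_injective hf h1] at hab
  exact ⟨b, h2, hab⟩

theorem reach_relabel_iff (hf : Function.Injective f) {x y : Literal m} :
    Reach (implicationDigraph (relabelCNF f F)) (relabel f x) (relabel f y) ↔
      Reach (implicationDigraph F) x y := by
  constructor
  · intro h
    obtain ⟨z, hz, hr⟩ := h.exists_of_map (exists_adj_of_adj_relabel hf)
    rwa [← relabel_injective hf hz]
  · exact Reach.map fun _ _ => adj_relabel

theorem IsSCC.relabel (hf : Function.Injective f) {C : Set (Literal m)}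
    (h : IsSCC (implicationDigraph F) C) :
    IsSCC (implicationDigraph (relabelCNF f F)) (relabel f '' C) := by
  rw [isSCC_iff] at h ⊢
  obtain ⟨hne, hC, hmax⟩ := h
  refine ⟨hne.image _, ?_, ?_⟩
  · rintro _ ⟨x, hx, rfl⟩ _ ⟨y, hy, rfl⟩
    exact (reach_relabel_iff hf).mpr (hC x hx y hy)
  · rintro _ ⟨x, hx, rfl⟩ y' hxy hyx
    obtain ⟨y, rfl, hr⟩ := hxy.exists_of_map (exists_adj_of_adj_relabel hf)
    exact ⟨y, hmax x hx y hr ((reach_relabel_iff hf).mp hyx), rfl⟩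

theorem isContradictorySCC_relabel_iff (hf : Function.Injective f) {C' : Set (Literal n)} :
    IsContradictorySCC (implicationDigraph (relabelCNF f F)) C' ↔
      ∃ C, IsContradictorySCC (implicationDigraph F) C ∧ relabel f '' C = C' := by
  constructor
  · intro h
    obtain ⟨hS, x, hx, hx'⟩ := isContradictorySCC_iff.mp h
    have hr := (isSCC_iff.mp hS).2.1 x hx _ hx'
    -- A literal outside the image of the relabeling has no outgoing arc, so it cannot reach its
    -- negation.
    obtain ⟨a, rfl⟩ : ∃ a, relabel f a = x := by
      rcases Relation.ReflTransGen.cases_head hr with h0 | ⟨z, hz, -⟩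
      · exact absurd h0.symm (neg_ne x)
      · obtain ⟨a, b, -, ha, -⟩ := mem_relabelCNF.mp hz
        exact ⟨neg a, by rw [relabel_neg, ha, neg_neg']⟩
    have ha := isSCC_component (G := implicationDigraph F) a
    have ha' : a ∈ {y | Reach (implicationDigraph F) a y ∧ Reach (implicationDigraph F) y a} :=
      ⟨Relation.ReflTransGen.refl, Relation.ReflTransGen.refl⟩
    rw [← relabel_neg] at hr hx'
    refine ⟨_, isContradictorySCC_iff.mpr ⟨ha, a, ha', (reach_relabel_iff hf).mp hr, ?_⟩,
      (ha.relabel hf).eq_of_mem hS ⟨a, ha', rfl⟩ hx⟩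
    exact (reach_relabel_iff hf).mp ((isSCC_iff.mp hS).2.1 _ hx' _ hx)
  · rintro ⟨C, hC, rfl⟩
    obtain ⟨hS, x, hx, hx'⟩ := isContradictorySCC_iff.mp hC
    exact isContradictorySCC_iff.mpr ⟨hS.relabel hf, _, ⟨x, hx, rfl⟩, ⟨_, hx', relabel_neg f x⟩⟩

theorem numContradictory_relabel (hf : Function.Injective f) :
    numContradictory (implicationDigraph (relabelCNF f F)) =
      numContradictory (implicationDigraph F) := by
  unfold numContradictory
  rw [← Set.ncard_image_of_injective _ (Set.image_injective.mpr (relabel_injective hf))]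
  congr 1
  ext C'
  exact isContradictorySCC_relabel_iff hf

/-- The total weight of the 2-CNFs on `m` variables, with a weight `x` for each contradictory
component. -/
def contrCoeff (x : K) (m : ℕ) : K :=
  ∑ F ∈ twoCNFs m, w ^ F.card * x ^ numContradictory (implicationDigraph F)

theorem sum_clausesOn (x : K) (R : Finset (Fin n)) :
    ∑ F ∈ (clausesOn R).powerset,
      w ^ F.card * x ^ numContradictory (implicationDigraph F) = contrCoeff x R.card := by
  obtain ⟨f, hf, hR⟩ := exists_parametrization R
  have he := Sym2.map.injective (relabel_injective hf)
  rw [clausesOn_eq_image hf hR, sum_powerset_image he, contrCoeff, twoCNFs]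
  refine Finset.sum_congr rfl fun F _ => ?_
  rw [Finset.card_image_of_injective _ he, ← relabelCNF, numContradictory_relabel hf]

open Classical in
-- A component containing all literals of a nonempty set of variables is automatically
-- contradictory, so connectivity is the only condition.
theorem sum_clausesOn_conn {R : Finset (Fin n)} (hne : R.Nonempty) :
    ∑ F ∈ (clausesOn R).powerset, (if Conn F (R ×ˢ Finset.univ) then w ^ F.card else 0) =
      csccCoeff R.card := by
  obtain ⟨f, hf, hR⟩ := exists_parametrization R
  have he := Sym2.map.injective (relabel_injective hf)
  rw [clausesOn_eq_image hf hR, sum_powerset_image he, csccCoeff, twoCNFs, Finset.sum_filter]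
  refine Finset.sum_congr rfl fun F _ => ?_
  rw [Finset.card_image_of_injective _ he, ← relabelCNF]
  refine if_congr ?_ rfl rfl
  have hfm : ∀ x : Literal R.card, relabel f x ∈ R ×ˢ (Finset.univ : Finset Bool) := fun x =>
    Finset.mem_product.mpr ⟨(hR _).mpr ⟨_, rfl⟩, Finset.mem_univ _⟩
  rw [isContradictorySCC_iff, isSCC_iff]
  constructor
  · intro h
    have x : Literal R.card := (⟨0, hne.card_pos⟩, true)
    exact ⟨⟨⟨x, trivial⟩, fun a _ b _ => (reach_relabel_iff hf).mp (h _ (hfm a) _ (hfm b)),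
      fun _ _ _ _ _ => trivial⟩, x, trivial, trivial⟩
  · rintro ⟨⟨-, h, -⟩, -⟩ a ha b hb
    obtain ⟨i, hi⟩ := (hR _).mp (Finset.mem_product.mp ha).1
    obtain ⟨j, hj⟩ := (hR _).mp (Finset.mem_product.mp hb).1
    have := (reach_relabel_iff hf).mpr (h (i, a.2) trivial (j, b.2) trivial)
    rwa [show relabel f (i, a.2) = a from Prod.ext hi rfl,
      show relabel f (j, b.2) = b from Prod.ext hj rfl] at this

end Components

/-! ### 2-CNFs with prescribed source-like and isolated ordinary components -/

section Partitions

variable {α : Type} [DecidableEq α] {S S' : Finset α} {P P' : Finset (Finset α)}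

theorem subset_of_mem_partitions (h : P ∈ partitions S) {B : Finset α} (hB : B ∈ P) : B ⊆ S :=
  (mem_partitions.mp h).2.2 ▸ Finset.subset_biUnion_of_mem id hB

theorem nonempty_of_mem_partitions (h : P ∈ partitions S) {B : Finset α} (hB : B ∈ P) :
    B.Nonempty :=
  Finset.nonempty_iff_ne_empty.mpr fun h0 => (mem_partitions.mp h).1 (h0 ▸ hB)

theorem exists_of_mem_partitions (h : P ∈ partitions S) {x : α} (hx : x ∈ S) :
    ∃ B ∈ P, x ∈ B := by
  rw [← (mem_partitions.mp h).2.2] at hx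
  simpa using hx

theorem eq_of_mem_partitions (h : P ∈ partitions S) {B B' : Finset α} (hB : B ∈ P)
    (hB' : B' ∈ P) {x : α} (hx : x ∈ B) (hx' : x ∈ B') : B = B' := by
  by_contra hne
  exact Finset.disjoint_left.mp ((mem_partitions.mp h).2.1 hB hB' hne) hx hx'

theorem disjoint_of_mem_partitions (hS : Disjoint S S') (h : P ∈ partitions S)
    (h' : P' ∈ partitions S') : Disjoint P P' := by
  rw [Finset.disjoint_left]
  intro B hB hB'
  obtain ⟨x, hx⟩ := nonempty_of_mem_partitions h hB
  exact Finset.disjoint_left.mp hS (subset_of_mem_partitions h hB hx)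
    (subset_of_mem_partitions h' hB' hx)

theorem union_mem_partitions (hS : Disjoint S S') (h : P ∈ partitions S)
    (h' : P' ∈ partitions S') : P ∪ P' ∈ partitions (S ∪ S') := by
  have hh := mem_partitions.mp h
  have hh' := mem_partitions.mp h'
  rw [mem_partitions]
  refine ⟨?_, ?_, ?_⟩
  · rw [Finset.mem_union, not_or]
    exact ⟨hh.1, hh'.1⟩
  · rw [Finset.coe_union, Set.pairwiseDisjoint_union]
    refine ⟨hh.2.1, hh'.2.1, fun B hB B' hB' _ => ?_⟩
    exact Finset.disjoint_of_subset_left (subset_of_mem_partitions h hB)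
      (Finset.disjoint_of_subset_right (subset_of_mem_partitions h' hB') hS)
  · rw [Finset.union_biUnion, hh.2.2, hh'.2.2]

end Partitions

/-! ### The clauses compatible with prescribed components -/

section Families

variable {n : ℕ} {F : Finset (Sym2 (Literal n))} {T Q : Finset (Finset (Literal n))}
  {L LT LQ : Finset (Literal n)} {R : Finset (Fin n)}

/-- The members of `T` are source-like ordinary components, and the members of `Q` are isolated
ordinary components. -/
def HasComponents (F : Finset (Sym2 (Literal n))) (T Q : Finset (Finset (Literal n))) : Prop :=
  (∀ C ∈ T, IsOrdinarySCC (implicationDigraph F) C ∧ SourceLike (implicationDigraph F) C) ∧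
    ∀ C ∈ Q, IsOrdinarySCC (implicationDigraph F) C ∧ Isolated (implicationDigraph F) C

/-- The clauses whose arcs go from `L` to the negations of the literals of `L` or to the literals
of the variables of `R`, and their contrapositives. -/
def outgoingClauses (L : Finset (Literal n)) (R : Finset (Fin n)) :
    Finset (Sym2 (Literal n)) :=
  ((L.image neg).offDiag.image fun p => s(p.1, p.2)) ∪
    ((L ×ˢ (R ×ˢ Finset.univ)).image fun p => s(neg p.1, p.2))

theorem mem_innerClauses_iff {C : Finset (Literal n)} {c : Sym2 (Literal n)} :
    c ∈ innerClauses C ↔ ∃ x ∈ C, ∃ y ∈ C, x ≠ y ∧ s(neg x, y) = c := by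
  simp only [innerClauses, Finset.mem_image, Finset.mem_offDiag]
  constructor
  · rintro ⟨p, ⟨h1, h2, h3⟩, h⟩
    exact ⟨_, h1, _, h2, h3, h⟩
  · rintro ⟨x, h1, y, h2, h3, h⟩
    exact ⟨(x, y), ⟨h1, h2, h3⟩, h⟩

theorem mem_outgoingClauses_iff {c : Sym2 (Literal n)} :
    c ∈ outgoingClauses L R ↔
      (∃ x ∈ L, ∃ y ∈ L, x ≠ y ∧ s(neg x, neg y) = c) ∨
        ∃ x ∈ L, ∃ y : Literal n, y.1 ∈ R ∧ s(neg x, y) = c := by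
  rw [outgoingClauses, Finset.mem_union, Finset.mem_image, Finset.mem_image]
  refine or_congr ?_ ?_
  · constructor
    · rintro ⟨⟨a, b⟩, h, rfl⟩
      rw [Finset.mem_offDiag] at h
      obtain ⟨x, hx, hxa⟩ := Finset.mem_image.mp h.1
      obtain ⟨y, hy, hyb⟩ := Finset.mem_image.mp h.2.1
      dsimp only at hxa hyb h
      refine ⟨x, hx, y, hy, ?_, by rw [hxa, hyb]⟩
      rintro rfl
      exact h.2.2 (hxa.symm.trans hyb)
    · rintro ⟨x, hx, y, hy, hxy, rfl⟩
      exact ⟨(neg x, neg y), Finset.mem_offDiag.mpr ⟨Finset.mem_image_of_mem _ hx,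
        Finset.mem_image_of_mem _ hy, fun h => hxy (neg_involutive.injective h)⟩, rfl⟩
  · constructor
    · rintro ⟨⟨x, y⟩, h, rfl⟩
      rw [Finset.mem_product, Finset.mem_product] at h
      exact ⟨x, h.1, y, h.2.1, rfl⟩
    · rintro ⟨x, hx, y, hy, rfl⟩
      exact ⟨(x, y), Finset.mem_product.mpr
        ⟨hx, Finset.mem_product.mpr ⟨hy, Finset.mem_univ _⟩⟩, rfl⟩

theorem Consistent.mono {L' : Finset (Literal n)} (h : Consistent L) (hL : L' ⊆ L) :
    Consistent L' :=
  fun x hx hx' => h x (hL hx) (hL hx')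

theorem Consistent.ne {x y : Literal n} (h : Consistent L) (hx : x ∈ L) (hy : y ∈ L) :
    neg x ≠ y := by
  rintro rfl
  exact h x hx hy

theorem Consistent.fst_ne {x y : Literal n} (h : Consistent L) (hx : x ∈ L) (hy : y ∈ L)
    (hxy : x ≠ y) : x.1 ≠ y.1 := by
  intro he
  rcases eq_or_eq_neg he with h' | h'
  · exact hxy h'
  · exact h y hy (h' ▸ hx)

/-- The clauses allowed in a 2-CNF with prescribed components. -/
def allowedClauses (X : Finset (Finset (Literal n))) (LT : Finset (Literal n))
    (R : Finset (Fin n)) : Finset (Sym2 (Literal n)) :=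
  X.biUnion innerClauses ∪ (outgoingClauses LT R ∪ clausesOn R)

/-- The possible positions of an arc from `a` to `b`. Each kind of clause is an unordered pair and
yields two contrapositive arcs, hence the mirror cases. -/
theorem clause_cases {X : Finset (Finset (Literal n))} {a b : Literal n}
    (h : s(neg a, b) ∈ allowedClauses X LT R) :
    (∃ C ∈ X, (a ∈ C ∧ b ∈ C) ∨ (neg a ∈ C ∧ neg b ∈ C)) ∨
      (a ∈ LT ∧ neg b ∈ LT) ∨ (a ∈ LT ∧ b.1 ∈ R) ∨ (neg b ∈ LT ∧ a.1 ∈ R) ∨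
        (a.1 ∈ R ∧ b.1 ∈ R) := by
  rw [allowedClauses, Finset.mem_union, Finset.mem_union, Finset.mem_biUnion] at h
  rcases h with ⟨C, hC, h⟩ | h | h
  · left
    refine ⟨C, hC, ?_⟩
    obtain ⟨x, hx, y, hy, -, h⟩ := mem_innerClauses_iff.mp h
    rcases Sym2.eq_iff.mp h with ⟨h1, rfl⟩ | ⟨rfl, rfl⟩
    · rw [neg_involutive.injective h1] at hx
      exact Or.inl ⟨hx, hy⟩
    · rw [neg_neg']
      exact Or.inr ⟨hy, hx⟩
  · right
    rcases mem_outgoingClauses_iff.mp h with ⟨x, hx, y, hy, -, h⟩ | ⟨x, hx, y, hy, h⟩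
    · left
      rcases Sym2.eq_iff.mp h with ⟨h1, rfl⟩ | ⟨rfl, h1⟩
      · rw [neg_involutive.injective h1] at hx
        rw [neg_neg']
        exact ⟨hx, hy⟩
      · rw [neg_involutive.injective h1] at hy
        rw [neg_neg']
        exact ⟨hy, hx⟩
    · right
      rcases Sym2.eq_iff.mp h with ⟨h1, rfl⟩ | ⟨rfl, rfl⟩
      · rw [neg_involutive.injective h1] at hx
        exact Or.inl ⟨hx, hy⟩
      · rw [neg_neg']
        exact Or.inr (Or.inl ⟨hx, hy⟩)
  · exact Or.inr (Or.inr (Or.inr (Or.inr (mem_clausesOn.mp h).2)))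

/-- If a literal of the clause lies in a prescribed component, the arc ending there must start in
the same component, and the clause is inner. Otherwise, an arc starting in `LQ` would leave an
isolated component, so the negation of each literal is in `LT` or its variable is uncovered; the
four combinations give outgoing clauses or clauses on the uncovered variables. -/
theorem subset_allowedClauses (hF : F ⊆ clauses n) (hT : T ∈ partitions LT)
    (hQ : Q ∈ partitions LQ) (h : HasComponents F T Q) :
    F ⊆ allowedClauses (T ∪ Q) LT (Finset.univ \ (LT ∪ LQ).image Prod.fst) := by
  intro c hc
  induction c using Sym2.ind with
  | _ a b =>
    have hab : a.1 ≠ b.1 := mem_clauses.mp (hF hc)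
    have hc' : s(b, a) ∈ F := Sym2.eq_swap ▸ hc
    have hsrc : ∀ C ∈ T ∪ Q, SourceLike (implicationDigraph F) C := fun C hC =>
      (Finset.mem_union.mp hC).elim (fun hC => (h.1 C hC).2) fun hC => (h.2 C hC).2.1
    have inner : ∀ a b : Literal n, a.1 ≠ b.1 → s(b, a) ∈ F → a ∈ LT ∪ LQ →
        s(b, a) ∈ allowedClauses (T ∪ Q) LT (Finset.univ \ (LT ∪ LQ).image Prod.fst) := by
      intro a b hab hba ha
      obtain ⟨C, hC, haC⟩ : ∃ C ∈ T ∪ Q, a ∈ C := by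
        rcases Finset.mem_union.mp ha with ha | ha
        · obtain ⟨C, hC, haC⟩ := exists_of_mem_partitions hT ha
          exact ⟨C, Finset.mem_union_left _ hC, haC⟩
        · obtain ⟨C, hC, haC⟩ := exists_of_mem_partitions hQ ha
          exact ⟨C, Finset.mem_union_right _ hC, haC⟩
      have hb : neg b ∈ C := by
        by_contra hb
        refine hsrc C hC _ hb _ haC ?_
        rwa [implicationDigraph_adj, neg_neg']
      refine Finset.mem_union_left _ (Finset.mem_biUnion.mpr ⟨C, hC, ?_⟩)
      exact mem_innerClauses_iff.mpr ⟨neg b, hb, a, haC,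
        fun h => hab (congrArg Prod.fst h).symm, by rw [neg_neg']⟩
    by_cases ha : a ∈ LT ∪ LQ
    · rw [Sym2.eq_swap]
      exact inner a b hab hc' ha
    by_cases hb : b ∈ LT ∪ LQ
    · exact inner b a hab.symm hc hb
    have sink : ∀ a b : Literal n, s(a, b) ∈ F → b ∉ LT ∪ LQ → neg a ∉ LQ := by
      intro a b hab hb ha
      obtain ⟨C, hC, haC⟩ := exists_of_mem_partitions hQ ha
      refine (h.2 C hC).2.2 _ haC b (fun hbC => hb (Finset.mem_union_right _
        (subset_of_mem_partitions hQ hC hbC))) ?_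
      rwa [implicationDigraph_adj, neg_neg']
    have haQ := sink a b hc hb
    have hbQ := sink b a hc' ha
    rw [allowedClauses, Finset.mem_union, Finset.mem_union]
    right
    by_cases haT : neg a ∈ LT <;> by_cases hbT : neg b ∈ LT
    · left
      exact mem_outgoingClauses_iff.mpr (Or.inl ⟨neg a, haT, neg b, hbT,
        fun h => hab (congrArg Prod.fst (neg_involutive.injective h)), by rw [neg_neg', neg_neg']⟩)
    · left
      refine mem_outgoingClauses_iff.mpr (Or.inr ⟨neg a, haT, b, ?_, by rw [neg_neg']⟩)
      exact fst_mem_compl_image_fst.mpr ⟨hb, by simp [hbT, hbQ]⟩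
    · left
      refine mem_outgoingClauses_iff.mpr (Or.inr ⟨neg b, hbT, a, ?_,
        by rw [neg_neg', Sym2.eq_swap]⟩)
      exact fst_mem_compl_image_fst.mpr ⟨ha, by simp [haT, haQ]⟩
    · right
      exact mem_clausesOn.mpr ⟨hab, fst_mem_compl_image_fst.mpr ⟨ha, by simp [haT, haQ]⟩,
        fst_mem_compl_image_fst.mpr ⟨hb, by simp [hbT, hbQ]⟩⟩

/-- Allowed clauses produce no arc entering a prescribed component and none leaving a member of `Q`.
For a source-like consistent set, being an ordinary component is then just internal connectivity,
which the inner clauses alone decide. -/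
theorem hasComponents_iff (hF : F ⊆ clauses n) (hd : Disjoint LT LQ)
    (hc : Consistent (LT ∪ LQ)) (hT : T ∈ partitions LT) (hQ : Q ∈ partitions LQ) :
    HasComponents F T Q ↔
      F ⊆ allowedClauses (T ∪ Q) LT (Finset.univ \ (LT ∪ LQ).image Prod.fst) ∧
        ∀ C ∈ T ∪ Q, Conn (F ∩ innerClauses C) C := by
  have hTQ := union_mem_partitions hd hT hQ
  constructor
  · intro h
    refine ⟨subset_allowedClauses hF hT hQ h, fun C hC => ?_⟩
    have hC' : IsOrdinarySCC (implicationDigraph F) C ∧ SourceLike (implicationDigraph F) C :=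
      (Finset.mem_union.mp hC).elim (h.1 C) fun hC => ⟨(h.2 C hC).1, (h.2 C hC).2.1⟩
    rw [conn_inter_iff hC'.2]
    exact ((isOrdinarySCC_iff_of_sourceLike hC'.2).mp hC'.1).2.2
  · rintro ⟨hA, hconn⟩
    have hsrc : ∀ C ∈ T ∪ Q, SourceLike (implicationDigraph F) C := by
      intro C hC x hx y hy hxy
      have hyL := subset_of_mem_partitions hTQ hC hy
      rcases clause_cases (hA hxy) with ⟨D, hD, ⟨h1, h2⟩ | ⟨h1, h2⟩⟩ | ⟨-, h⟩ | ⟨-, h⟩ |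
        ⟨h, -⟩ | ⟨-, h⟩
      · rw [eq_of_mem_partitions hTQ hC hD hy h2] at hx
        exact hx h1
      · exact hc y hyL (subset_of_mem_partitions hTQ hD h2)
      · exact hc y hyL (Finset.mem_union_left _ h)
      · exact (fst_mem_compl_image_fst.mp h).1 hyL
      · exact hc y hyL (Finset.mem_union_left _ h)
      · exact (fst_mem_compl_image_fst.mp h).1 hyL
    have hsink : ∀ C ∈ Q, SinkLike (implicationDigraph F) C := by
      intro C hC x hx y hy hxy
      have hxQ := subset_of_mem_partitions hQ hC hx
      have hxL := Finset.mem_union_right LT hxQ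
      have hxT : x ∉ LT := fun h => Finset.disjoint_left.mp hd h hxQ
      have hC' := Finset.mem_union_right T hC
      rcases clause_cases (hA hxy) with ⟨D, hD, ⟨h1, h2⟩ | ⟨h1, h2⟩⟩ | ⟨h, -⟩ | ⟨h, -⟩ |
        ⟨-, h⟩ | ⟨h, -⟩
      · rw [eq_of_mem_partitions hTQ hC' hD hx h1] at hy
        exact hy h2
      · exact hc x hxL (subset_of_mem_partitions hTQ hD h1)
      · exact hxT h
      · exact hxT h
      · exact (fst_mem_compl_image_fst.mp h).1 hxL
      · exact (fst_mem_compl_image_fst.mp h).1 hxL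
    have hord : ∀ C ∈ T ∪ Q, IsOrdinarySCC (implicationDigraph F) C := fun C hC =>
      (isOrdinarySCC_iff_of_sourceLike (hsrc C hC)).mpr ⟨nonempty_of_mem_partitions hTQ hC,
        hc.mono (subset_of_mem_partitions hTQ hC), (conn_inter_iff (hsrc C hC)).mp (hconn C hC)⟩
    exact ⟨fun C hC => ⟨hord C (Finset.mem_union_left _ hC), hsrc C (Finset.mem_union_left _ hC)⟩,
      fun C hC => ⟨hord C (Finset.mem_union_right _ hC),
        hsrc C (Finset.mem_union_right _ hC), hsink C hC⟩⟩

theorem allowedClauses_subset {X : Finset (Finset (Literal n))}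
    (hX : X ∈ partitions L) (hc : Consistent L) (hLT : LT ⊆ L) :
    allowedClauses X LT (Finset.univ \ L.image Prod.fst) ⊆ clauses n := by
  intro c h
  rw [allowedClauses, Finset.mem_union, Finset.mem_union, Finset.mem_biUnion] at h
  rcases h with ⟨C, hC, h⟩ | h | h
  · obtain ⟨x, hx, y, hy, hxy, rfl⟩ := mem_innerClauses_iff.mp h
    rw [mem_clauses, neg_fst]
    exact hc.fst_ne (subset_of_mem_partitions hX hC hx) (subset_of_mem_partitions hX hC hy) hxy
  · rcases mem_outgoingClauses_iff.mp h with ⟨x, hx, y, hy, hxy, rfl⟩ | ⟨x, hx, y, hy, rfl⟩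
    · rw [mem_clauses, neg_fst, neg_fst]
      exact hc.fst_ne (hLT hx) (hLT hy) hxy
    · rw [mem_clauses]
      intro he
      rw [← he, fst_mem_compl_image_fst, neg_neg'] at hy
      exact hy.2 (hLT hx)
  · exact Finset.filter_subset _ _ h

theorem disjoint_innerClauses {C D : Finset (Literal n)} (hCD : Disjoint C D) (hC : C ⊆ L)
    (hD : D ⊆ L) (hc : Consistent L) : Disjoint (innerClauses C) (innerClauses D) := by
  rw [Finset.disjoint_left]
  intro c h h'
  obtain ⟨x, hx, y, hy, -, rfl⟩ := mem_innerClauses_iff.mp h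
  obtain ⟨x', hx', y', hy', -, h⟩ := mem_innerClauses_iff.mp h'
  rcases Sym2.eq_iff.mp h with ⟨-, rfl⟩ | ⟨h, -⟩
  · exact Finset.disjoint_left.mp hCD hy hy'
  · exact hc.ne (hD hx') (hC hy) h

theorem disjoint_biUnion_innerClauses {X : Finset (Finset (Literal n))}
    (hX : X ∈ partitions L) (hc : Consistent L) (hLT : LT ⊆ L) :
    Disjoint (X.biUnion innerClauses) (outgoingClauses LT (Finset.univ \ L.image Prod.fst) ∪
      clausesOn (Finset.univ \ L.image Prod.fst)) := by
  rw [Finset.disjoint_left]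
  intro c h h'
  obtain ⟨C, hC, h⟩ := Finset.mem_biUnion.mp h
  obtain ⟨x, hx, y, hy, -, rfl⟩ := mem_innerClauses_iff.mp h
  have hx := subset_of_mem_partitions hX hC hx
  have hy := subset_of_mem_partitions hX hC hy
  rcases Finset.mem_union.mp h' with h | h
  · rcases mem_outgoingClauses_iff.mp h with ⟨x', hx', y', hy', -, h⟩ | ⟨x', hx', y', hy', h⟩
    · rcases Sym2.eq_iff.mp h with ⟨-, h⟩ | ⟨h, -⟩
      · exact hc.ne (hLT hy') hy h
      · exact hc.ne (hLT hx') hy h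
    · rcases Sym2.eq_iff.mp h with ⟨-, rfl⟩ | ⟨h, -⟩
      · exact (fst_mem_compl_image_fst.mp hy').1 hy
      · exact hc.ne (hLT hx') hy h
  · exact (fst_mem_compl_image_fst.mp (mem_clausesOn.mp h).2.2).1 hy

theorem disjoint_outgoingClauses_clausesOn (hLT : LT ⊆ L) :
    Disjoint (outgoingClauses LT (Finset.univ \ L.image Prod.fst))
      (clausesOn (Finset.univ \ L.image Prod.fst)) := by
  rw [Finset.disjoint_left]
  intro c h h'
  rcases mem_outgoingClauses_iff.mp h with ⟨x, hx, y, -, -, rfl⟩ | ⟨x, hx, y, -, rfl⟩ <;>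
  · have := (fst_mem_compl_image_fst.mp (mem_clausesOn.mp h').2.1).2
    rw [neg_neg'] at this
    exact this (hLT hx)

/-- Either both literals are negations of literals of `LT`, an unordered pair, or one is, and the
other is one of the two literals of an uncovered variable. -/
theorem card_outgoingClauses (hLT : LT ⊆ L) :
    (outgoingClauses LT (Finset.univ \ L.image Prod.fst)).card =
      LT.card.choose 2 + 2 * LT.card * (Finset.univ \ L.image Prod.fst).card := by
  have hR : ∀ x ∈ LT, ∀ y : Literal n, y.1 ∈ Finset.univ \ L.image Prod.fst → neg x ≠ y := by
    rintro x hx y hy rfl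
    rw [fst_mem_compl_image_fst, neg_neg'] at hy
    exact hy.2 (hLT hx)
  rw [outgoingClauses, Finset.card_union_of_disjoint]
  · congr 1
    · exact (Sym2.card_image_offDiag _).trans (by rw [Finset.card_image_of_injective _ neg_involutive.injective])
    · rw [Finset.card_image_of_injOn, Finset.card_product, Finset.card_product,
        Finset.card_univ, Fintype.card_bool]
      · ring
      · rintro ⟨x, y⟩ h ⟨x', y'⟩ h' he
        rw [Finset.mem_coe, Finset.mem_product, Finset.mem_product] at h h'
        rcases Sym2.eq_iff.mp he with ⟨h1, h2⟩ | ⟨h1, -⟩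
        · exact Prod.ext (neg_involutive.injective h1) h2
        · exact absurd h1 (hR x h.1 y' h'.2.1)
  · rw [Finset.disjoint_left]
    intro c h h'
    obtain ⟨⟨x, y⟩, hy, rfl⟩ := Finset.mem_image.mp h'
    rw [Finset.mem_product, Finset.mem_product] at hy
    obtain ⟨⟨a, b⟩, hab, he⟩ := Finset.mem_image.mp h
    rw [Finset.mem_offDiag] at hab
    obtain ⟨a', ha', haa⟩ := Finset.mem_image.mp hab.1
    obtain ⟨b', hb', hbb⟩ := Finset.mem_image.mp hab.2.1
    rcases Sym2.eq_iff.mp he with ⟨-, h2⟩ | ⟨h1, -⟩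
    · exact hR b' hb' y hy.2.1 (hbb.trans h2)
    · exact hR a' ha' y hy.2.1 (haa.trans h1)

end Families

/-! ### Total weight with prescribed components, and expansion over distinguished families -/

section Families

variable {n : ℕ} {F : Finset (Sym2 (Literal n))} {T Q : Finset (Finset (Literal n))}
  {L LT LQ : Finset (Literal n)}

theorem sourceLike_of_hasComponents (hT : T ∈ partitions LT) (hQ : Q ∈ partitions LQ)
    (h : HasComponents F T Q) :
    SourceLike (implicationDigraph F) ((LT ∪ LQ : Finset (Literal n)) : Set (Literal n)) := by
  intro x hx y hy hxy
  rcases Finset.mem_union.mp hy with hy | hy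
  · obtain ⟨C, hC, hyC⟩ := exists_of_mem_partitions hT hy
    exact (h.1 C hC).2 x (fun hxC => hx (Finset.mem_union_left _
      (subset_of_mem_partitions hT hC hxC))) y hyC hxy
  · obtain ⟨C, hC, hyC⟩ := exists_of_mem_partitions hQ hy
    exact (h.2 C hC).2.1 x (fun hxC => hx (Finset.mem_union_right _
      (subset_of_mem_partitions hQ hC hxC))) y hyC hxy

theorem card_allowed_decomposition {X : Finset (Finset (Literal n))}
    (hX : X ∈ partitions L) (hc : Consistent L) (hLT : LT ⊆ L)
    (hF : F ⊆ allowedClauses X LT (Finset.univ \ L.image Prod.fst)) :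
    F.card = ∑ C ∈ X, (F ∩ innerClauses C).card +
      ((F ∩ outgoingClauses LT (Finset.univ \ L.image Prod.fst)).card +
        (F ∩ clausesOn (Finset.univ \ L.image Prod.fst)).card) := by
  have h1 := disjoint_biUnion_innerClauses hX hc hLT
  have h2 := disjoint_outgoingClauses_clausesOn hLT
  have h3 : (X : Set (Finset (Literal n))).PairwiseDisjoint fun C => F ∩ innerClauses C := by
    intro C hC D hD hCD
    refine (disjoint_innerClauses ((mem_partitions.mp hX).2.1 hC hD hCD)
      (subset_of_mem_partitions hX hC) (subset_of_mem_partitions hX hD) hc).mono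
      Finset.inter_subset_right Finset.inter_subset_right
  conv_lhs => rw [← Finset.inter_eq_left.mpr hF, allowedClauses, Finset.inter_union_distrib_left,
    Finset.inter_union_distrib_left, Finset.inter_biUnion]
  rw [Finset.card_union_of_disjoint, Finset.card_union_of_disjoint, Finset.card_biUnion h3]
  · exact h2.mono Finset.inter_subset_right Finset.inter_subset_right
  · rw [← Finset.inter_biUnion, ← Finset.inter_union_distrib_left]
    exact h1.mono Finset.inter_subset_right Finset.inter_subset_right

open Classical in
-- Inner clauses of the various members, outgoing clauses and clauses on uncovered variables are
-- pairwise disjoint sets, and the summand factors accordingly. Outgoing clauses are unconstrained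
-- and give a power of `1 + w`; contradictory components are seen by the last factor only.
theorem sum_hasComponents (hd : Disjoint LT LQ)
    (hc : Consistent (LT ∪ LQ)) (hT : T ∈ partitions LT) (hQ : Q ∈ partitions LQ) (x : K) :
    ∑ F ∈ twoCNFs n with HasComponents F T Q,
        w ^ F.card * x ^ numContradictory (implicationDigraph F) =
      (∏ C ∈ T, sccCoeff C.card) * (∏ C ∈ Q, sccCoeff C.card) *
        ((1 + w) ^ (LT.card.choose 2 +
            2 * LT.card * (Finset.univ \ (LT ∪ LQ).image Prod.fst).card) *
          contrCoeff x (Finset.univ \ (LT ∪ LQ).image Prod.fst).card) := by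
  set L := LT ∪ LQ with hL
  set R := Finset.univ \ L.image Prod.fst with hR
  have hLT : LT ⊆ L := Finset.subset_union_left
  have hTQ : T ∪ Q ∈ partitions L := union_mem_partitions hd hT hQ
  have hpd : ((T ∪ Q : Finset _) : Set (Finset (Literal n))).PairwiseDisjoint innerClauses :=
    fun C hC D hD hCD => disjoint_innerClauses ((mem_partitions.mp hTQ).2.1 hC hD hCD)
      (subset_of_mem_partitions hTQ hC) (subset_of_mem_partitions hTQ hD) hc
  have e1 : ∀ F ∈ (allowedClauses (T ∪ Q) LT R).powerset,
      (if HasComponents F T Q then w ^ F.card * x ^ numContradictory (implicationDigraph F)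
        else 0) =
      (∏ C ∈ T ∪ Q, if Conn (F ∩ innerClauses C) C then w ^ (F ∩ innerClauses C).card else 0) *
        (w ^ (F ∩ outgoingClauses LT R).card * (w ^ (F ∩ clausesOn R).card *
          x ^ numContradictory (implicationDigraph (F ∩ clausesOn R)))) := by
    intro F hF
    rw [Finset.mem_powerset] at hF
    have hFc : F ⊆ clauses n := hF.trans (allowedClauses_subset hTQ hc hLT)
    rw [Finset.prod_ite_zero]
    by_cases h : HasComponents F T Q
    · have h' := (hasComponents_iff hFc hd hc hT hQ).mp h
      rw [if_pos h, if_pos h'.2, Finset.prod_pow_eq_pow_sum,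
        card_allowed_decomposition hTQ hc hLT hF, pow_add, pow_add,
        numContradictory_inter_clausesOn hFc hc (sourceLike_of_hasComponents hT hQ h)]
      ring
    · have h' : ¬ ∀ C ∈ T ∪ Q, Conn (F ∩ innerClauses C) C := fun h' =>
        h ((hasComponents_iff hFc hd hc hT hQ).mpr ⟨hF, h'⟩)
      rw [if_neg h, if_neg h', zero_mul]
  have e2 : ∑ F ∈ twoCNFs n with HasComponents F T Q,
        w ^ F.card * x ^ numContradictory (implicationDigraph F) =
      ∑ F ∈ (allowedClauses (T ∪ Q) LT R).powerset,
        (if HasComponents F T Q then w ^ F.card * x ^ numContradictory (implicationDigraph F)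
          else 0) := by
    rw [Finset.sum_filter]
    symm
    refine Finset.sum_subset
      (Finset.powerset_mono.mpr (allowedClauses_subset hTQ hc hLT)) fun F hF hF' => ?_
    rw [if_neg]
    intro h
    have hFc : F ⊆ clauses n := Finset.mem_powerset.mp hF
    exact hF' (Finset.mem_powerset.mpr ((hasComponents_iff hFc hd hc hT hQ).mp h).1)
  have e3 := sum_powerset_union (disjoint_biUnion_innerClauses hTQ hc hLT)
    (fun F => ∏ C ∈ T ∪ Q, if Conn (F ∩ innerClauses C) C
      then w ^ (F ∩ innerClauses C).card else 0)
    (fun F => w ^ (F ∩ outgoingClauses LT R).card * (w ^ (F ∩ clausesOn R).card *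
          x ^ numContradictory (implicationDigraph (F ∩ clausesOn R))))
  have e4 := sum_powerset_union (disjoint_outgoingClauses_clausesOn hLT)
    (fun F => w ^ F.card)
    (fun F => w ^ F.card * x ^ numContradictory (implicationDigraph F))
  have e5 := sum_powerset_biUnion hpd
    (fun C F => if Conn F C then w ^ F.card else 0)
  rw [← hR] at e3 e4
  rw [e2, Finset.sum_congr rfl e1]
  have e6 : ∀ F : Finset (Sym2 (Literal n)), ∀ C ∈ T ∪ Q,
      F ∩ ((T ∪ Q).biUnion innerClauses) ∩ innerClauses C = F ∩ innerClauses C := by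
    intro F C hC
    rw [Finset.inter_assoc, Finset.inter_eq_right.mpr (Finset.subset_biUnion_of_mem _ hC)]
  have e7 : ∀ F : Finset (Sym2 (Literal n)),
      F ∩ (outgoingClauses LT R ∪ clausesOn R) ∩ outgoingClauses LT R =
        F ∩ outgoingClauses LT R := fun F => by
    rw [Finset.inter_assoc, Finset.union_inter_cancel_left]
  have e8 : ∀ F : Finset (Sym2 (Literal n)),
      F ∩ (outgoingClauses LT R ∪ clausesOn R) ∩ clausesOn R = F ∩ clausesOn R := fun F => by
    rw [Finset.inter_assoc, Finset.union_inter_cancel_right]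
  have e9 : ∀ F : Finset (Sym2 (Literal n)),
      (∏ C ∈ T ∪ Q, if Conn (F ∩ (T ∪ Q).biUnion innerClauses ∩ innerClauses C) C then
          w ^ (F ∩ (T ∪ Q).biUnion innerClauses ∩ innerClauses C).card else 0) =
        ∏ C ∈ T ∪ Q, if Conn (F ∩ innerClauses C) C then w ^ (F ∩ innerClauses C).card else 0 :=
    fun F => Finset.prod_congr rfl fun C hC => by rw [e6 F C hC]
  simp only [e7, e8, e9] at e3
  rw [allowedClauses, e3, e5, e4, sum_clausesOn]
  have e10 : ∑ F ∈ (outgoingClauses LT R).powerset, w ^ F.card =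
      (1 + w) ^ (LT.card.choose 2 + 2 * LT.card * R.card) := by
    rw [hR, ← card_outgoingClauses hLT, ← Finset.prod_const, Finset.prod_one_add]
    simp
  rw [e10, ← Finset.prod_union (disjoint_of_mem_partitions hd hT hQ)]
  congr 1
  refine Finset.prod_congr rfl fun C hC => ?_
  exact sum_innerClauses (nonempty_of_mem_partitions hTQ hC)
    (hc.mono (subset_of_mem_partitions hTQ hC))

/-! ### Marking source-like components -/

open Classical in
/-- The source-like ordinary components. -/
def sourceFamily (G : Digraph (Literal n)) : Finset (Finset (Literal n)) :=
  Finset.univ.filter fun C : Finset (Literal n) => IsOrdinarySCC G C ∧ SourceLike G C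

open Classical in
/-- The isolated ordinary components. -/
def isolatedFamily (G : Digraph (Literal n)) : Finset (Finset (Literal n)) :=
  Finset.univ.filter fun C : Finset (Literal n) => IsOrdinarySCC G C ∧ Isolated G C

theorem mem_sourceFamily {G : Digraph (Literal n)} {C : Finset (Literal n)} :
    C ∈ sourceFamily G ↔ IsOrdinarySCC G C ∧ SourceLike G C := by
  simp [sourceFamily]

theorem mem_isolatedFamily {G : Digraph (Literal n)} {C : Finset (Literal n)} :
    C ∈ isolatedFamily G ↔ IsOrdinarySCC G C ∧ Isolated G C := by
  simp [isolatedFamily]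

theorem numSource_eq (G : Digraph (Literal n)) :
    numSource G = (sourceFamily G \ isolatedFamily G).card := by
  classical
  rw [numSource, ncard_setOf_eq_card]
  congr 1
  ext C
  rw [Finset.mem_filter, Finset.mem_sdiff, mem_sourceFamily, mem_isolatedFamily]
  simp only [Finset.mem_univ, true_and]
  tauto

theorem numIsolatedPairs_eq (G : Digraph (Literal n)) :
    numIsolatedPairs G = ((isolatedFamily G).image fun C => s(C, C.image neg)).card := by
  classical
  rw [numIsolatedPairs, ← Set.ncard_coe_finset,
    ← Set.ncard_image_of_injective _ (Sym2.map.injective Finset.coe_injective)]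
  congr 1
  ext P
  simp only [Finset.coe_image, Set.mem_image, Finset.mem_coe, mem_isolatedFamily,
    Set.mem_ofPred_eq, exists_exists_and_eq_and, Sym2.map_mk]
  constructor
  · rintro ⟨C, h1, h2, rfl⟩
    exact ⟨C.toFinset, by simpa using ⟨h1, h2⟩, by simp⟩
  · rintro ⟨C, h, rfl⟩
    exact ⟨C, h.1, h.2, rfl⟩

theorem image_neg_involutive :
    Function.Involutive fun C : Finset (Literal n) => C.image neg := by
  intro C
  dsimp only
  rw [Finset.image_image, neg_involutive.comp_self, Finset.image_id]

/-- Disjoint sets of literals whose union has no two opposite literals. -/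
def Admissible (LT LQ : Finset (Literal n)) : Prop := Disjoint LT LQ ∧ Consistent (LT ∪ LQ)

open Classical in
-- This is `sum_independent_pairs` for negation acting on source-like components, with the chosen
-- families regrouped according to the literals they cover. Distinct components are disjoint, so the
-- families are partitions of their unions; and two members contain opposite literals exactly when
-- they are opposite components, so independence of the families becomes consistency of the covered
-- set.
theorem weight_eq_sum (F : Finset (Sym2 (Literal n))) (t ρ : K) :
    (1 + t) ^ numSource (implicationDigraph F) *
        (1 + 2 * (t + ρ)) ^ numIsolatedPairs (implicationDigraph F) =
      ∑ p : Finset (Literal n) × Finset (Literal n) with Admissible p.1 p.2,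
        ∑ T ∈ partitions p.1, ∑ Q ∈ partitions p.2,
          if HasComponents F T Q then t ^ T.card * ρ ^ Q.card else 0 := by
  set G := implicationDigraph F
  set S := sourceFamily G with hS
  set I := isolatedFamily G with hI
  have hmS : ∀ C, C ∈ S ↔ IsOrdinarySCC G C ∧ SourceLike G C := fun _ => mem_sourceFamily
  have hmI : ∀ C, C ∈ I ↔ IsOrdinarySCC G C ∧ Isolated G C := fun _ => mem_isolatedFamily
  have hIS : I ⊆ S := fun C hC =>
    (hmS C).mpr ⟨((hmI C).mp hC).1, ((hmI C).mp hC).2.1⟩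
  have hσ : ∀ C ∈ S, C.image neg ∈ S ↔ C ∈ I := by
    intro C hC
    have hC' := (hmS C).mp hC
    rw [hmS, hmI, Finset.coe_image, sourceLike_image_neg]
    exact ⟨fun h => ⟨hC'.1, hC'.2, h.2⟩, fun h => ⟨hC'.1.image_neg, h.2.2⟩⟩
  have hmem : ∀ {C : Finset (Literal n)} {x}, x ∈ C.image neg ↔ neg x ∈ C := fun {C x} => by
    rw [← Finset.mem_coe, Finset.coe_image, mem_image_neg, Finset.mem_coe]
  have hcons : ∀ C ∈ S, Consistent C := fun C hC =>
    (isOrdinarySCC_iff.mp ((hmS C).mp hC).1).2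
  have hscc : ∀ C ∈ S, IsSCC G C := fun C hC => ((hmS C).mp hC).1.1
  have hnon : ∀ C ∈ S, C.Nonempty := fun C hC => (hscc C hC).1
  have hne : ∀ C ∈ I, C.image neg ≠ C := by
    intro C hC h
    obtain ⟨x, hx⟩ := hnon C (hIS hC)
    have hx' := hx
    rw [← h, hmem] at hx'
    exact hcons C (hIS hC) x hx hx'
  have heq : ∀ C ∈ S, ∀ D ∈ S, ∀ x ∈ C, x ∈ D → C = D := fun C hC D hD x hx hx' =>
    Finset.coe_injective ((hscc C hC).eq_of_mem (hscc D hD) hx hx')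
  have heq' : ∀ C ∈ S, ∀ D ∈ S, ∀ x ∈ C, neg x ∈ D → C.image neg = D := fun C hC D hD x hx hx' =>
    Finset.coe_injective (IsSCC.eq_of_mem (by
      rw [Finset.coe_image]
      exact (hscc C hC).image_neg) (hscc D hD) (x := neg x)
      (Finset.mem_coe.mpr (hmem.mpr (by rwa [neg_neg']))) hx')
  have hpart : ∀ P ⊆ S, P ∈ partitions (P.biUnion id) := by
    intro P hP
    refine mem_partitions.mpr ⟨fun h => Finset.not_nonempty_empty (hnon _ (hP h)),
      fun C hC D hD hCD => Finset.disjoint_left.mpr fun x hx hx' => hCD ?_, rfl⟩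
    exact heq C (hP hC) D (hP hD) x hx hx'
  rw [numSource_eq, numIsolatedPairs_eq, ← hS, ← hI,
    ← sum_independent_pairs image_neg_involutive hIS hσ hne]
  simp_rw [← Finset.sum_product', Finset.sum_sigma']
  rw [← Finset.sum_filter]
  refine Finset.sum_bij' (fun p _ => ⟨(p.1.biUnion id, p.2.biUnion id), p⟩)
    (fun q _ => q.2) ?_ ?_ ?_ ?_ ?_
  · rintro ⟨T, Q⟩ hp
    simp only [Finset.mem_filter, Finset.mem_product, Finset.mem_powerset] at hp
    obtain ⟨⟨hT, hQ⟩, hd, hind⟩ := hp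
    have hQS := hQ.trans hIS
    simp only [Finset.mem_filter, Finset.mem_sigma, Finset.mem_univ, true_and,
      Finset.mem_product]
    refine ⟨⟨⟨?_, ?_⟩, hpart T hT, hpart Q hQS⟩, fun C hC => (hmS C).mp (hT hC),
      fun C hC => (hmI C).mp (hQ hC)⟩
    · rw [Finset.disjoint_left]
      intro x hx hx'
      obtain ⟨C, hC, hxC⟩ := Finset.mem_biUnion.mp hx
      obtain ⟨D, hD, hxD⟩ := Finset.mem_biUnion.mp hx'
      have := heq C (hT hC) D (hQS hD) x hxC hxD
      exact Finset.disjoint_left.mp hd hC (this ▸ hD)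
    · rw [← Finset.union_biUnion]
      intro x hx hx'
      obtain ⟨C, hC, hxC⟩ := Finset.mem_biUnion.mp hx
      obtain ⟨D, hD, hxD⟩ := Finset.mem_biUnion.mp hx'
      have hTQ := Finset.union_subset hT hQS
      have := heq' C (hTQ hC) D (hTQ hD) x hxC hxD
      exact hind C hC (this ▸ hD)
  · rintro ⟨⟨LT, LQ⟩, T, Q⟩ hq
    simp only [Finset.mem_filter, Finset.mem_sigma, Finset.mem_univ, true_and,
      Finset.mem_product] at hq
    obtain ⟨⟨⟨hd, hc⟩, hT, hQ⟩, h1, h2⟩ := hq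
    simp only [Finset.mem_filter, Finset.mem_product, Finset.mem_powerset]
    refine ⟨⟨fun C hC => (hmS C).mpr (h1 C hC), fun C hC => (hmI C).mpr (h2 C hC)⟩,
      disjoint_of_mem_partitions hd hT hQ, fun C hC hC' => ?_⟩
    have hTQ := union_mem_partitions hd hT hQ
    obtain ⟨x, hx⟩ := nonempty_of_mem_partitions hTQ hC
    refine hc x (subset_of_mem_partitions hTQ hC hx) (subset_of_mem_partitions hTQ hC' ?_)
    rwa [hmem, neg_neg']
  · rintro ⟨T, Q⟩ _
    rfl
  · rintro ⟨⟨LT, LQ⟩, T, Q⟩ hq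
    simp only [Finset.mem_filter, Finset.mem_sigma, Finset.mem_univ, true_and,
      Finset.mem_product] at hq
    obtain ⟨⟨-, hT, hQ⟩, -⟩ := hq
    dsimp only
    rw [(mem_partitions.mp hT).2.2, (mem_partitions.mp hQ).2.2]
  · rintro ⟨T, Q⟩ _
    rfl

end Families

/-! ### The generating function with marked source-like components -/

section Counting

variable {n : ℕ}

theorem Consistent.injOn_fst {L : Finset (Literal n)} (h : Consistent L) :
    Set.InjOn Prod.fst (L : Set (Literal n)) := by
  intro x hx y hy hxy
  by_contra hne
  exact h.fst_ne hx hy hne hxy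

theorem Consistent.card_image_fst {L : Finset (Literal n)} (h : Consistent L) :
    (L.image Prod.fst).card = L.card :=
  Finset.card_image_of_injOn h.injOn_fst

/-- The literals of the variables of `S` that are true under the assignment `P`. -/
def signed (S P : Finset (Fin n)) : Finset (Literal n) := S.image fun i => (i, decide (i ∈ P))

theorem mem_signed {S P : Finset (Fin n)} {x : Literal n} :
    x ∈ signed S P ↔ x.1 ∈ S ∧ (x.2 = true ↔ x.1 ∈ P) := by
  rw [signed, Finset.mem_image]
  constructor
  · rintro ⟨i, hi, rfl⟩
    simpa using hi
  · rintro ⟨h1, h2⟩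
    exact ⟨x.1, h1, Prod.ext rfl (by rw [Bool.eq_iff_iff, decide_eq_true_iff, h2])⟩

theorem consistent_signed (S P : Finset (Fin n)) : Consistent (signed S P) := by
  intro x hx hx'
  have h1 := (mem_signed.mp hx).2
  have h2 := (mem_signed.mp hx').2
  rw [neg_fst, ← h1] at h2
  simp [neg] at h2

theorem image_fst_signed (S P : Finset (Fin n)) : (signed S P).image Prod.fst = S := by
  rw [signed, Finset.image_image]
  exact Finset.image_id

open Classical in
-- A consistent set amounts to its set `S` of variables together with the subset `P` of those that
-- occur positively, which accounts for `2 ^ k`.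
theorem sum_consistent (A : Finset (Fin n)) (g : ℕ → K) :
    ∑ L : Finset (Literal n) with Consistent L ∧ L.image Prod.fst ⊆ A, g L.card =
      ∑ k ∈ Finset.range (A.card + 1), (A.card.choose k : K) * (2 ^ k * g k) := by
  have e1 : ∑ S ∈ A.powerset, ∑ P ∈ S.powerset, g S.card =
      ∑ k ∈ Finset.range (A.card + 1), (A.card.choose k : K) * (2 ^ k * g k) := by
    have : ∀ S ∈ A.powerset, ∑ P ∈ S.powerset, g S.card =
        (fun k => 2 ^ k * g k) S.card := by
      intro S _
      rw [Finset.sum_const, Finset.card_powerset, nsmul_eq_mul]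
      push_cast
      rfl
    rw [Finset.sum_congr rfl this, Finset.sum_powerset_apply_card (fun k => 2 ^ k * g k)]
    simp only [nsmul_eq_mul]
  rw [← e1, Finset.sum_sigma']
  refine Finset.sum_bij' (fun L _ => ⟨L.image Prod.fst, (L.filter fun x => x.2).image Prod.fst⟩)
    (fun p _ => signed p.1 p.2) ?_ ?_ ?_ ?_ ?_
  · intro L hL
    simp only [Finset.mem_filter, Finset.mem_univ, true_and] at hL
    simp only [Finset.mem_sigma, Finset.mem_powerset]
    exact ⟨hL.2, Finset.image_subset_image (Finset.filter_subset _ _)⟩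
  · rintro ⟨S, P⟩ h
    simp only [Finset.mem_sigma, Finset.mem_powerset] at h
    simp only [Finset.mem_filter, Finset.mem_univ, true_and]
    rw [image_fst_signed]
    exact ⟨consistent_signed S P, h.1⟩
  · intro L hL
    simp only [Finset.mem_filter, Finset.mem_univ, true_and] at hL
    ext x
    rw [mem_signed, Finset.mem_image, Finset.mem_image]
    constructor
    · rintro ⟨⟨y, hy, hyx⟩, h⟩
      by_cases hxy : y = x
      · exact hxy ▸ hy
      · have hyn : y = neg x := (eq_or_eq_neg hyx).resolve_left hxy
        exfalso
        by_cases hx2 : x.2 = true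
        · obtain ⟨z, hz, hzx⟩ := h.mp hx2
          rw [Finset.mem_filter] at hz
          have : z = y := hL.1.injOn_fst hz.1 hy (hzx.trans hyx.symm)
          rw [this, hyn] at hz
          simp [neg, hx2] at hz
        · refine hx2 (h.mpr ⟨y, Finset.mem_filter.mpr ⟨hy, ?_⟩, hyx⟩)
          rw [hyn]
          simpa [neg] using hx2
    · intro hx
      refine ⟨⟨x, hx, rfl⟩, fun h => ⟨x, Finset.mem_filter.mpr ⟨hx, h⟩, rfl⟩, ?_⟩
      rintro ⟨z, hz, hzx⟩
      rw [Finset.mem_filter] at hz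
      rw [← hL.1.injOn_fst hz.1 hx hzx]
      exact hz.2
  · rintro ⟨S, P⟩ h
    simp only [Finset.mem_sigma, Finset.mem_powerset] at h
    have h2 : ((signed S P).filter fun x => x.2).image Prod.fst = P := by
      ext i
      rw [Finset.mem_image]
      constructor
      · rintro ⟨x, hx, rfl⟩
        rw [Finset.mem_filter, mem_signed] at hx
        exact hx.1.2.mp hx.2
      · intro hi
        exact ⟨(i, true), Finset.mem_filter.mpr ⟨mem_signed.mpr ⟨h.2 hi, by simpa using hi⟩, rfl⟩,
          rfl⟩
    dsimp only
    rw [image_fst_signed, h2]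
  · intro L hL
    simp only [Finset.mem_filter, Finset.mem_univ, true_and] at hL
    exact congrArg g hL.1.card_image_fst.symm

theorem admissible_iff {LT LQ : Finset (Literal n)} :
    Admissible LT LQ ↔ Consistent LQ ∧ Consistent LT ∧
      LT.image Prod.fst ⊆ Finset.univ \ LQ.image Prod.fst := by
  constructor
  · rintro ⟨hd, hc⟩
    refine ⟨hc.mono Finset.subset_union_right, hc.mono Finset.subset_union_left, ?_⟩
    intro i hi
    obtain ⟨x, hx, rfl⟩ := Finset.mem_image.mp hi
    rw [fst_mem_compl_image_fst]
    exact ⟨fun h => Finset.disjoint_left.mp hd hx h,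
      fun h => hc x (Finset.mem_union_left _ hx) (Finset.mem_union_right _ h)⟩
  · rintro ⟨hQ, hT, hsub⟩
    have h : ∀ x ∈ LT, x ∉ LQ ∧ neg x ∉ LQ := fun x hx =>
      fst_mem_compl_image_fst.mp (hsub (Finset.mem_image_of_mem _ hx))
    refine ⟨Finset.disjoint_left.mpr fun x hx => (h x hx).1, fun x hx hx' => ?_⟩
    rcases Finset.mem_union.mp hx with hx | hx <;> rcases Finset.mem_union.mp hx' with hx' | hx'
    · exact hT x hx hx'
    · exact (h x hx).2 hx'
    · exact (h _ hx').2 (by rwa [neg_neg'])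
    · exact hQ x hx hx'

open Classical in
-- `LQ` is chosen first, then `LT` among the variables that `LQ` leaves free; `admissible_iff` makes
-- the two choices successive.
theorem sum_admissible (n : ℕ) (g : ℕ → ℕ → K) :
    ∑ p : Finset (Literal n) × Finset (Literal n) with Admissible p.1 p.2,
        g p.2.card p.1.card =
      ∑ j ∈ Finset.range (n + 1), (n.choose j : K) * (2 ^ j *
        ∑ k ∈ Finset.range (n - j + 1), ((n - j).choose k : K) * (2 ^ k * g j k)) := by
  have e := sum_consistent (Finset.univ : Finset (Fin n)) (fun j =>
    ∑ k ∈ Finset.range (n - j + 1), ((n - j).choose k : K) * (2 ^ k * g j k))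
  rw [Finset.card_univ, Fintype.card_fin] at e
  rw [← e, Finset.sum_filter, Finset.sum_filter, Fintype.sum_prod_type_right]
  refine Finset.sum_congr rfl fun LQ _ => ?_
  rw [← Finset.sum_filter]
  by_cases hQ : Consistent LQ
  · rw [if_pos ⟨hQ, Finset.subset_univ _⟩]
    have hcard : (Finset.univ \ LQ.image Prod.fst).card = n - LQ.card := by
      rw [Finset.card_sdiff_of_subset (Finset.subset_univ _), Finset.card_univ, Fintype.card_fin,
        hQ.card_image_fst]
    rw [← hcard, ← sum_consistent _ (g LQ.card)]
    refine Finset.sum_congr (Finset.filter_congr fun LT _ => ?_) fun _ _ => rfl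
    rw [admissible_iff, and_iff_right hQ]
  · rw [if_neg fun h => hQ h.1, Finset.filter_false_of_mem, Finset.sum_empty]
    intro LT _ h
    exact hQ (admissible_iff.mp h).1

theorem Admissible.card_compl {LT LQ : Finset (Literal n)} (h : Admissible LT LQ) :
    (Finset.univ \ (LT ∪ LQ).image Prod.fst).card = n - LQ.card - LT.card := by
  rw [Finset.card_sdiff_of_subset (Finset.subset_univ _), Finset.card_univ, Fintype.card_fin,
    h.2.card_image_fst, Finset.card_union_of_disjoint h.1, add_comm, Nat.sub_sub]

/-- The generating function of implication digraphs with arbitrary weights for the source-like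
ordinary components, the isolated pairs and the contradictory components. -/
def cnfCoeff (a b x : K) (n : ℕ) : K :=
  ∑ F ∈ twoCNFs n, w ^ F.card * a ^ numSource (implicationDigraph F)
    * b ^ numIsolatedPairs (implicationDigraph F)
    * x ^ numContradictory (implicationDigraph F)

theorem CNF_eq : CNF = egf (cnfCoeff u v s) := rfl

/-- Expand the weights by `weight_eq_sum`, exchange the sums, and evaluate the sum over 2-CNFs by
`sum_hasComponents`. The sums over partitions then become exponentials, and the summand depends only
on the sizes of `LT` and `LQ`. -/
theorem cnfCoeff_eq (t ρ x : K) (n : ℕ) :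
    cnfCoeff (1 + t) (1 + 2 * (t + ρ)) x n =
      ∑ j ∈ Finset.range (n + 1), (n.choose j : K) * (2 ^ j *
        ∑ k ∈ Finset.range (n - j + 1), ((n - j).choose k : K) * (2 ^ k *
          (expCoeff (fun i => ρ * sccCoeff i) j * (expCoeff (fun i => t * sccCoeff i) k *
            ((1 + w) ^ (k.choose 2 + 2 * k * (n - j - k)) * contrCoeff x (n - j - k)))))) := by
  classical
  rw [← sum_admissible n (fun j k => expCoeff (fun i => ρ * sccCoeff i) j *
    (expCoeff (fun i => t * sccCoeff i) k *
      ((1 + w) ^ (k.choose 2 + 2 * k * (n - j - k)) * contrCoeff x (n - j - k))))]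
  have e1 : ∀ F ∈ twoCNFs n,
      w ^ F.card * (1 + t) ^ numSource (implicationDigraph F)
        * (1 + 2 * (t + ρ)) ^ numIsolatedPairs (implicationDigraph F)
        * x ^ numContradictory (implicationDigraph F) =
      ∑ p : Finset (Literal n) × Finset (Literal n) with Admissible p.1 p.2,
        ∑ T ∈ partitions p.1, ∑ Q ∈ partitions p.2,
          t ^ T.card * ρ ^ Q.card * if HasComponents F T Q then
            w ^ F.card * x ^ numContradictory (implicationDigraph F) else 0 := by
    intro F _
    rw [mul_assoc (w ^ F.card), weight_eq_sum, mul_right_comm, Finset.mul_sum]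
    refine Finset.sum_congr rfl fun p _ => ?_
    rw [Finset.mul_sum]
    refine Finset.sum_congr rfl fun T _ => ?_
    rw [Finset.mul_sum]
    refine Finset.sum_congr rfl fun Q _ => ?_
    split_ifs
    · ring
    · ring
  rw [cnfCoeff, Finset.sum_congr rfl e1, Finset.sum_comm]
  refine Finset.sum_congr rfl fun p hp => ?_
  have hp : Admissible p.1 p.2 := (Finset.mem_filter.mp hp).2
  rw [← sum_partitions_eq_expCoeff (by rw [sccCoeff_zero, mul_zero]),
    ← sum_partitions_eq_expCoeff (by rw [sccCoeff_zero, mul_zero]), Finset.sum_comm]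
  have e2 : ∀ T ∈ partitions p.1, ∑ F ∈ twoCNFs n, ∑ Q ∈ partitions p.2,
      (t ^ T.card * ρ ^ Q.card * if HasComponents F T Q then
        w ^ F.card * x ^ numContradictory (implicationDigraph F) else 0) =
      ∑ Q ∈ partitions p.2, (∏ C ∈ Q, ρ * sccCoeff C.card) * ((∏ C ∈ T, t * sccCoeff C.card) *
        ((1 + w) ^ (p.1.card.choose 2 + 2 * p.1.card * (n - p.2.card - p.1.card)) *
          contrCoeff x (n - p.2.card - p.1.card))) := by
    intro T hT
    rw [Finset.sum_comm]
    refine Finset.sum_congr rfl fun Q hQ => ?_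
    rw [← Finset.mul_sum, ← Finset.sum_filter, sum_hasComponents hp.1 hp.2 hT hQ,
      hp.card_compl, Finset.prod_mul_distrib, Finset.prod_mul_distrib, Finset.prod_const,
      Finset.prod_const]
    ring
  rw [Finset.sum_congr rfl e2, Finset.sum_comm, Finset.sum_mul]
  refine Finset.sum_congr rfl fun Q _ => ?_
  rw [← Finset.mul_sum, ← Finset.sum_mul]

end Counting

/-! ### Passing to generating functions -/

theorem one_add_w_ne_zero : (1 + w : K) ≠ 0 := by
  have h : (1 + w : K) = algebraMap (MvPolynomial Mark ℚ) K (1 + MvPolynomial.X Mark.w) := by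
    rw [map_add, map_one, w]
  rw [h, Ne, IsFractionRing.to_map_eq_zero_iff]
  intro h0
  have := congrArg (MvPolynomial.eval fun _ => (0 : ℚ)) h0
  simp at this

/-- The bookkeeping of exponents of `1 + w`: the terms on the right come from `SetHat`, from the
outgoing clauses, and from the normalization of `implicationSeries`; the left side is the exponent
in `D`. -/
theorem add_mul_pred (k m : ℕ) :
    (k + m) * (k + m - 1) = k.choose 2 + (k.choose 2 + 2 * k * m) + m * (m - 1) := by
  have hk : k.choose 2 + k.choose 2 = k * (k - 1) := by
    have := Nat.div_mul_cancel (Nat.even_mul_pred_self k).two_dvd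
    rw [Nat.choose_two_right]
    omega
  rcases k with _ | k
  · simp
  · rcases m with _ | m
    · simp at hk ⊢
      linarith
    · simp only [Nat.add_sub_cancel, ← Nat.add_assoc] at hk ⊢
      nlinarith

/-- The implication generating function of implication digraphs with contradictory components
marked by `x`. -/
def implicationSeries (x : K) : K⟦X⟧ :=
  egf fun m => contrCoeff x m / ((1 + w) ^ (m * (m - 1)) * 2 ^ m)

theorem egf_cnfCoeff (t ρ x : K) :
    egf (cnfCoeff (1 + t) (1 + 2 * (t + ρ)) x) =
      expS (ρ • atTwoZ SCC) * hadamard (atTwoZ D)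
        (hadamard (expS (t • SCC)) SetHat * implicationSeries x) := by
  have e1 : expS (ρ • atTwoZ SCC) = egf fun j => 2 ^ j * expCoeff (fun i => ρ * sccCoeff i) j := by
    rw [SCC_eq, atTwoZ_egf, smul_egf, ← egf_expCoeff]
    congr 1
    funext j
    rw [← expCoeff_two_pow_mul (by rw [sccCoeff_zero, mul_zero])]
    congr 1
    funext i
    ring
  rw [e1, SCC_eq, smul_egf, ← egf_expCoeff, SetHat, hadamard_egf, implicationSeries, egf_mul_egf,
    D, atTwoZ_egf, hadamard_egf, egf_mul_egf]
  congr 1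
  funext n
  rw [cnfCoeff_eq]
  refine Finset.sum_congr rfl fun j _ => ?_
  rw [mul_assoc (2 ^ j)]
  congr 2
  simp only [Finset.mul_sum]
  refine Finset.sum_congr rfl fun k hk => ?_
  obtain ⟨m, hm⟩ := Nat.exists_eq_add_of_le (Nat.lt_succ_iff.mp (Finset.mem_range.mp hk))
  have hm' : n - j - k = m := by omega
  rw [hm', hm, add_mul_pred, pow_add, pow_add, pow_add]
  have h2 : (2 : K) ≠ 0 := two_ne_zero
  have hw := one_add_w_ne_zero
  field_simp
  rw [pow_add, pow_add]
  ring

/-! ### 2-CNFs without ordinary source-like components -/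

section Contradictory

variable {n : ℕ} {F : Finset (Sym2 (Literal n))} {P : Finset (Finset (Fin n))}

/-- The literals of a set of variables. -/
def literals (B : Finset (Fin n)) : Finset (Literal n) := B ×ˢ Finset.univ

theorem mem_literals {B : Finset (Fin n)} {x : Literal n} : x ∈ literals B ↔ x.1 ∈ B := by
  rw [literals, Finset.mem_product, and_iff_left (Finset.mem_univ _)]

/-- Every member of `P` is the set of variables of a source-like contradictory component. -/
def HasContradictory (F : Finset (Sym2 (Literal n))) (P : Finset (Finset (Fin n))) : Prop :=
  ∀ B ∈ P, SourceLike (implicationDigraph F) (literals B) ∧ Conn F (literals B)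

theorem isContradictorySCC_literals {B : Finset (Fin n)} (hB : B.Nonempty)
    (hs : SourceLike (implicationDigraph F) (literals B)) (hc : Conn F (literals B)) :
    IsContradictorySCC (implicationDigraph F) (literals B) := by
  obtain ⟨i, hi⟩ := hB
  have hi' : (i, true) ∈ literals B := mem_literals.mpr hi
  exact isContradictorySCC_iff.mpr ⟨hs.isSCC ⟨_, hi'⟩ hc, (i, true), hi', mem_literals.mpr hi⟩

theorem disjoint_clausesOn {B B' : Finset (Fin n)} (h : Disjoint B B') :
    Disjoint (clausesOn B) (clausesOn B') := by
  rw [Finset.disjoint_left]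
  intro c
  induction c using Sym2.ind with
  | _ a b =>
    intro hc hc'
    exact Finset.disjoint_left.mp h (mem_clausesOn.mp hc).2.1 (mem_clausesOn.mp hc').2.1

theorem conn_inter_clausesOn_iff (hF : F ⊆ clauses n) {B : Finset (Fin n)}
    (hs : SourceLike (implicationDigraph F) (literals B)) :
    Conn (F ∩ clausesOn B) (literals B) ↔ Conn F (literals B) := by
  refine ⟨fun h x hx y hy => reach_mono Finset.inter_subset_left (h x hx y hy), fun h => ?_⟩
  intro x hx y hy
  have hxy := h x hx y hy
  induction hxy using Relation.ReflTransGen.head_induction_on with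
  | refl => exact Relation.ReflTransGen.refl
  | @head a b hab hby ih =>
    have hb : b ∈ literals B := hs.mem_of_reach hby hy
    refine Relation.ReflTransGen.head (Finset.mem_inter.mpr ⟨hab, ?_⟩) (ih hb)
    rw [mem_clausesOn]
    exact ⟨mem_clauses.mp (hF hab), mem_literals (x := a).mp hx, mem_literals.mp hb⟩

/-- When the blocks cover all variables and are all source-like, no arc joins two of them: every
clause lives on a single block. -/
theorem hasContradictory_iff (hF : F ⊆ clauses n) (hP : P ∈ partitions Finset.univ) :
    HasContradictory F P ↔
      F ⊆ P.biUnion clausesOn ∧ ∀ B ∈ P, Conn (F ∩ clausesOn B) (literals B) := by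
  constructor
  · intro h
    refine ⟨fun c hc => ?_, fun B hB => (conn_inter_clausesOn_iff hF (h B hB).1).mpr (h B hB).2⟩
    induction c using Sym2.ind with
    | _ a b =>
      obtain ⟨B, hB, ha⟩ := exists_of_mem_partitions hP (Finset.mem_univ a.1)
      have hb : b.1 ∈ B := by
        by_contra hb
        refine (h B hB).1 (neg b) (fun hb' => hb (mem_literals (x := neg b).mp hb')) a
          (mem_literals.mpr ha) ?_
        rw [implicationDigraph_adj, neg_neg', Sym2.eq_swap]
        exact hc
      exact Finset.mem_biUnion.mpr ⟨B, hB, mem_clausesOn.mpr ⟨mem_clauses.mp (hF hc), ha, hb⟩⟩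
  · rintro ⟨hsub, hconn⟩ B hB
    have hs : SourceLike (implicationDigraph F) (literals B) := by
      intro x hx y hy hxy
      obtain ⟨B', hB', h⟩ := Finset.mem_biUnion.mp (hsub hxy)
      obtain ⟨-, h1, h2⟩ := mem_clausesOn.mp h
      have : B = B' := eq_of_mem_partitions hP hB hB' (mem_literals.mp hy) h2
      exact hx (mem_literals.mpr (this ▸ h1))
    exact ⟨hs, (conn_inter_clausesOn_iff hF hs).mp (hconn B hB)⟩

open Classical in
theorem sum_hasContradictory (hP : P ∈ partitions (Finset.univ : Finset (Fin n))) :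
    ∑ F ∈ twoCNFs n with HasContradictory F P, w ^ F.card = ∏ B ∈ P, csccCoeff B.card := by
  have hpd : (P : Set (Finset (Fin n))).PairwiseDisjoint clausesOn := fun B hB D hD hBD =>
    disjoint_clausesOn ((mem_partitions.mp hP).2.1 hB hD hBD)
  have hsub : P.biUnion clausesOn ⊆ clauses n :=
    Finset.biUnion_subset.mpr fun B _ => Finset.filter_subset _ _
  have e1 : ∏ B ∈ P, csccCoeff B.card =
      ∏ B ∈ P, ∑ F ∈ (clausesOn B).powerset, if Conn F (literals B) then w ^ F.card else 0 :=
    Finset.prod_congr rfl fun B hB =>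
      (sum_clausesOn_conn (nonempty_of_mem_partitions hP hB)).symm
  rw [e1, ← sum_powerset_biUnion hpd
    (fun B F => if Conn F (literals B) then w ^ F.card else 0), Finset.sum_filter]
  symm
  refine (Finset.sum_congr rfl fun F hF => ?_).trans
    (Finset.sum_subset (Finset.powerset_mono.mpr hsub) fun F hF hF' => ?_)
  · rw [Finset.mem_powerset] at hF
    have hi := hasContradictory_iff (hF.trans hsub) hP
    by_cases h : HasContradictory F P
    · rw [if_pos h, Finset.prod_congr rfl fun B hB => if_pos ((hi.mp h).2 B hB),
        Finset.prod_pow_eq_pow_sum, ← Finset.card_biUnion, ← Finset.inter_biUnion,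
        Finset.inter_eq_left.mpr hF]
      exact fun B hB D hD hBD => (hpd hB hD hBD).mono Finset.inter_subset_right
        Finset.inter_subset_right
    · obtain ⟨B, hB, hc⟩ : ∃ B ∈ P, ¬ Conn (F ∩ clausesOn B) (literals B) := by
        by_contra! hc
        exact h (hi.mpr ⟨hF, hc⟩)
      rw [if_neg h, Finset.prod_eq_zero hB (if_neg hc)]
  · rw [if_neg]
    intro h
    exact hF' (Finset.mem_powerset.mpr
      ((hasContradictory_iff (Finset.mem_powerset.mp hF) hP).mp h).1)

theorem IsContradictorySCC.eq_literals {C : Set (Literal n)}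
    (h : IsContradictorySCC (implicationDigraph F) C) :
    ∃ B : Finset (Fin n), C = literals B := by
  classical
  refine ⟨Finset.univ.filter fun i => (i, true) ∈ C, ?_⟩
  ext ⟨i, b⟩
  rw [Finset.mem_coe, mem_literals, Finset.mem_filter, and_iff_right (Finset.mem_univ _)]
  cases b
  · exact ⟨fun hx => h.neg_mem hx, fun hx => h.neg_mem hx⟩
  · exact Iff.rfl

theorem literals_injective : Function.Injective (literals : Finset (Fin n) → _) := by
  intro B B' h
  ext i
  rw [← mem_literals (x := (i, true)), h, mem_literals]

open Classical in
/-- The sets of variables of the contradictory components. -/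
def contradictoryBlocks (F : Finset (Sym2 (Literal n))) : Finset (Finset (Fin n)) :=
  Finset.univ.filter fun B : Finset (Fin n) =>
    IsContradictorySCC (implicationDigraph F) (literals B)

theorem mem_contradictoryBlocks {B : Finset (Fin n)} :
    B ∈ contradictoryBlocks F ↔ IsContradictorySCC (implicationDigraph F) (literals B) := by
  simp [contradictoryBlocks]

theorem card_contradictoryBlocks :
    (contradictoryBlocks F).card = numContradictory (implicationDigraph F) := by
  rw [numContradictory, ← Set.ncard_coe_finset, ← Set.ncard_image_of_injective _
    (Finset.coe_injective.comp literals_injective)]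
  congr 1
  ext C
  simp only [Set.mem_image, Finset.mem_coe, mem_contradictoryBlocks, Set.mem_ofPred_eq,
    Function.comp_apply]
  constructor
  · rintro ⟨B, hB, rfl⟩
    exact hB
  · intro h
    obtain ⟨B, rfl⟩ := h.eq_literals
    exact ⟨B, h, rfl⟩

theorem HasContradictory.eq_contradictoryBlocks (hP : P ∈ partitions Finset.univ)
    (h : HasContradictory F P) : P = contradictoryBlocks F := by
  have hmem : ∀ B ∈ P, IsContradictorySCC (implicationDigraph F) (literals B) := fun B hB =>
    isContradictorySCC_literals (nonempty_of_mem_partitions hP hB) (h B hB).1 (h B hB).2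
  ext B
  rw [mem_contradictoryBlocks]
  refine ⟨hmem B, fun hB => ?_⟩
  obtain ⟨x, hx⟩ := hB.1.1
  obtain ⟨B', hB', hxB'⟩ := exists_of_mem_partitions hP (Finset.mem_univ x.1)
  have : literals B = literals B' := Finset.coe_injective
    (hB.1.eq_of_mem (hmem B' hB').1 hx (Finset.mem_coe.mpr (mem_literals.mpr hxB')))
  rwa [literals_injective this]

theorem HasContradictory.sourceFamily_eq_empty (hP : P ∈ partitions Finset.univ)
    (h : HasContradictory F P) : sourceFamily (implicationDigraph F) = ∅ := by
  rw [Finset.eq_empty_iff_forall_notMem]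
  intro C hC
  obtain ⟨hord, -⟩ := mem_sourceFamily.mp hC
  obtain ⟨x, hx⟩ := hord.1.1
  obtain ⟨B, hB, hxB⟩ := exists_of_mem_partitions hP (Finset.mem_univ x.1)
  have hcB := isContradictorySCC_literals (nonempty_of_mem_partitions hP hB) (h B hB).1 (h B hB).2
  have : (C : Set (Literal n)) = literals B :=
    hord.1.eq_of_mem hcB.1 hx (Finset.mem_coe.mpr (mem_literals.mpr hxB))
  exact hord.2 (this ▸ hcB)

/-- The converse structural fact: without ordinary source-like components, the contradictory
components cover all literals and are source-like. -/
theorem contradictoryBlocks_mem_partitions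
    (h : sourceFamily (implicationDigraph F) = ∅) :
    contradictoryBlocks F ∈ partitions Finset.univ ∧ HasContradictory F (contradictoryBlocks F) := by
  have key : ∀ y : Literal n, ∃ B, y ∈ literals B ∧
      IsContradictorySCC (implicationDigraph F) (literals B) ∧
        SourceLike (implicationDigraph F) (literals B) := by
    intro y
    obtain ⟨C, hC, hs, x, hx, hxy⟩ := exists_sourceLike_reach (G := implicationDigraph F) y
    have hcon : IsContradictorySCC (implicationDigraph F) C := by
      classical
      by_contra hcon
      have : C.toFinset ∈ sourceFamily (implicationDigraph F) := by
        rw [mem_sourceFamily, Set.coe_toFinset]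
        exact ⟨⟨hC, hcon⟩, hs⟩
      rw [h] at this
      exact Finset.notMem_empty _ this
    obtain ⟨B, rfl⟩ := hcon.eq_literals
    refine ⟨B, ?_, hcon, hs⟩
    -- The contrapositive path leads from the negation of `y` to the negation of `x`, which lies in
    -- the source-like component; so that component contains the variable of `y`.
    have := hs.mem_of_reach (reach_neg hxy) (hcon.neg_mem hx)
    rw [Finset.mem_coe, mem_literals] at this
    exact mem_literals.mpr this
  have hsrc : ∀ B ∈ contradictoryBlocks F,
      SourceLike (implicationDigraph F) (literals B) := by
    intro B hB
    rw [mem_contradictoryBlocks] at hB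
    obtain ⟨x, hx⟩ := hB.1.1
    obtain ⟨B', hxB', hB', hs⟩ := key x
    rwa [hB.1.eq_of_mem hB'.1 hx (Finset.mem_coe.mpr hxB')]
  refine ⟨mem_partitions.mpr ⟨?_, ?_, ?_⟩, fun B hB => ⟨hsrc B hB, ?_⟩⟩
  · intro h0
    rw [mem_contradictoryBlocks] at h0
    obtain ⟨x, hx⟩ := h0.1.1
    exact Finset.notMem_empty _ (mem_literals.mp (Finset.mem_coe.mp hx))
  · intro B hB D hD hBD
    rw [Finset.mem_coe, mem_contradictoryBlocks] at hB hD
    rw [Function.onFun, id, id, Finset.disjoint_left]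
    intro i hi hi'
    exact hBD (literals_injective (Finset.coe_injective (hB.1.eq_of_mem hD.1
      (x := (i, true)) (Finset.mem_coe.mpr (mem_literals.mpr hi))
      (Finset.mem_coe.mpr (mem_literals.mpr hi')))))
  · rw [Finset.eq_univ_iff_forall]
    intro i
    obtain ⟨B, hi, hB, -⟩ := key (i, true)
    exact Finset.mem_biUnion.mpr ⟨B, mem_contradictoryBlocks.mpr hB, mem_literals.mp hi⟩
  · exact (isSCC_iff.mp (mem_contradictoryBlocks.mp hB).1).2.1

open Classical in
-- With `0 ^ 0 = 1`, the left side selects the 2-CNFs without ordinary source-like components. For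
-- these exactly one partition contributes, the one into contradictory blocks; for the others none
-- does.
theorem zero_weight_eq_sum (F : Finset (Sym2 (Literal n))) (x : K) :
    (0 : K) ^ numSource (implicationDigraph F) * 0 ^ numIsolatedPairs (implicationDigraph F) *
        x ^ numContradictory (implicationDigraph F) =
      ∑ P ∈ partitions (Finset.univ : Finset (Fin n)),
        if HasContradictory F P then x ^ P.card else 0 := by
  by_cases h : sourceFamily (implicationDigraph F) = ∅
  · obtain ⟨h1, h2⟩ := contradictoryBlocks_mem_partitions h
    have hI : isolatedFamily (implicationDigraph F) = ∅ := by
      rw [Finset.eq_empty_iff_forall_notMem] at h ⊢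
      intro C hC
      rw [mem_isolatedFamily] at hC
      exact h C (mem_sourceFamily.mpr ⟨hC.1, hC.2.1⟩)
    rw [Finset.sum_eq_single_of_mem _ h1, if_pos h2, card_contradictoryBlocks, numSource_eq,
      numIsolatedPairs_eq, h, hI]
    · simp
    · intro P hP hne
      exact if_neg fun hP' => hne (hP'.eq_contradictoryBlocks hP)
  · rw [Finset.sum_eq_zero fun P hP => if_neg fun hP' => h (hP'.sourceFamily_eq_empty hP)]
    obtain ⟨C, hC⟩ := Finset.nonempty_iff_ne_empty.mpr h
    by_cases hI : C ∈ isolatedFamily (implicationDigraph F)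
    · have : numIsolatedPairs (implicationDigraph F) ≠ 0 := by
        rw [numIsolatedPairs_eq]
        exact Finset.card_ne_zero_of_mem (Finset.mem_image_of_mem _ hI)
      rw [zero_pow this, mul_zero, zero_mul]
    · have : numSource (implicationDigraph F) ≠ 0 := by
        rw [numSource_eq]
        exact Finset.card_ne_zero_of_mem (Finset.mem_sdiff.mpr ⟨hC, hI⟩)
      rw [zero_pow this, zero_mul, zero_mul]

theorem cnfCoeff_zero (x : K) (n : ℕ) :
    cnfCoeff 0 0 x n = expCoeff (fun i => x * csccCoeff i) n := by
  classical
  have h := sum_partitions_eq_expCoeff (a := fun i => x * csccCoeff i)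
    (by rw [csccCoeff_zero, mul_zero]) (Finset.univ : Finset (Fin n))
  rw [Finset.card_univ, Fintype.card_fin] at h
  rw [← h, cnfCoeff]
  have e1 : ∀ F ∈ twoCNFs n,
      w ^ F.card * 0 ^ numSource (implicationDigraph F)
        * 0 ^ numIsolatedPairs (implicationDigraph F)
        * x ^ numContradictory (implicationDigraph F) =
      ∑ P ∈ partitions (Finset.univ : Finset (Fin n)),
        x ^ P.card * if HasContradictory F P then w ^ F.card else 0 := by
    intro F _
    rw [mul_assoc, mul_assoc, ← mul_assoc (0 ^ _), zero_weight_eq_sum, Finset.mul_sum]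
    refine Finset.sum_congr rfl fun P _ => ?_
    split_ifs <;> ring
  rw [Finset.sum_congr rfl e1, Finset.sum_comm]
  refine Finset.sum_congr rfl fun P hP => ?_
  rw [← Finset.mul_sum, ← Finset.sum_filter, sum_hasContradictory hP, Finset.prod_mul_distrib,
    Finset.prod_const]

theorem egf_cnfCoeff_zero (x : K) : egf (cnfCoeff 0 0 x) = expS (x • CSCC) := by
  rw [CSCC_eq, smul_egf, ← egf_expCoeff]
  exact congrArg egf (funext (cnfCoeff_zero x))

end Contradictory

/-! ### The main identity -/

/-- The exponential coefficients of `SetDdot` are the inverses of those of `D(2z)`, so the Hadamard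
product with `D(2z)` can be undone. -/
theorem hadamard_atTwoZ_D_SetDdot (A : K⟦X⟧) :
    hadamard (hadamard (atTwoZ D) A) SetDdot = A := by
  rw [← egf_factorial_mul_coeff A, D, SetDdot, atTwoZ_egf, hadamard_egf, hadamard_egf]
  congr 1
  funext n
  have h2 : (2 : K) ≠ 0 := two_ne_zero
  have hw := one_add_w_ne_zero
  field_simp

theorem constantCoeff_SCC : constantCoeff SCC = 0 := by
  rw [SCC_eq, constantCoeff_egf, sccCoeff_zero]

theorem constantCoeff_atTwoZ_SCC : constantCoeff (atTwoZ SCC) = 0 := by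
  rw [SCC_eq, atTwoZ_egf, constantCoeff_egf, sccCoeff_zero, mul_zero]

theorem constantCoeff_CSCC : constantCoeff CSCC = 0 := by
  rw [CSCC_eq, constantCoeff_egf, csccCoeff_zero]

theorem implicationSeries_eq (x : K) :
    implicationSeries x =
      hadamard (expS (x • CSCC - (1 / 2 : K) • atTwoZ SCC)) SetDdot *
        (hadamard (expS (-SCC)) SetHat)⁻¹ := by
  -- These values solve `1 + t = 0` and `1 + 2 * (t + ρ) = 0`, so the left side becomes `expS (x •
  -- CSCC)`.
  have h := egf_cnfCoeff (-1) (1 / 2) x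
  rw [show (1 + -1 : K) = 0 by ring, show (1 + 2 * (-1 + 1 / 2) : K) = 0 by norm_num,
    egf_cnfCoeff_zero, neg_one_smul] at h
  set A := (1 / 2 : K) • atTwoZ SCC with hA
  set P := hadamard (expS (-SCC)) SetHat with hP
  have hA0 : constantCoeff A = 0 := by
    simp [hA, constantCoeff_atTwoZ_SCC]
  have hB0 : constantCoeff (x • CSCC - A) = 0 := by
    simp [hA0, constantCoeff_CSCC]
  have hE : expS A ≠ 0 := by
    intro h0
    have := constantCoeff_expS hA0
    rw [h0, map_zero] at this
    exact zero_ne_one this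
  -- The factor `expS A` is split off so that it cancels against the one in the product formula.
  have h1 : expS (x • CSCC) = expS A * expS (x • CSCC - A) := by
    rw [← expS_add hA0 hB0, add_sub_cancel]
  rw [h1] at h
  have h2 := mul_left_cancel₀ hE h
  have hP0 : constantCoeff P ≠ 0 := by
    have : constantCoeff P = 1 := by
      have hS : constantCoeff (expS (-SCC)) = 1 :=
        constantCoeff_expS (by rw [map_neg, constantCoeff_SCC, neg_zero])
      rw [hP, hadamard, constantCoeff_egf, SetHat, coeff_egf, coeff_zero_eq_constantCoeff_apply, hS]
      simp
    rw [this]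
    exact one_ne_zero
  rw [h2, hadamard_atTwoZ_D_SetDdot, mul_comm P, mul_assoc, PowerSeries.mul_inv_cancel _ hP0,
    mul_one]

end TwoSat

end

theorem mainTheorem5 :
    TwoSat.CNF =
      TwoSat.expS (((TwoSat.v + 1 - 2 * TwoSat.u) / 2) • TwoSat.atTwoZ TwoSat.SCC) *
        TwoSat.hadamard (TwoSat.atTwoZ TwoSat.D)
          (TwoSat.hadamard (TwoSat.expS ((TwoSat.u - 1) • TwoSat.SCC)) TwoSat.SetHat *
            TwoSat.hadamard
              (TwoSat.expS (TwoSat.s • TwoSat.CSCC -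
                (1 / 2 : TwoSat.K) • TwoSat.atTwoZ TwoSat.SCC))
              TwoSat.SetDdot *
            (TwoSat.hadamard (TwoSat.expS (-TwoSat.SCC)) TwoSat.SetHat)⁻¹) := by
  rw [mul_assoc (TwoSat.hadamard (TwoSat.expS ((TwoSat.u - 1) • TwoSat.SCC)) TwoSat.SetHat),
    ← TwoSat.implicationSeries_eq, ← TwoSat.egf_cnfCoeff, TwoSat.CNF_eq,
    -- The choice of `t` and `ρ` is the solution of `1 + t = u` and `1 + 2 * (t + ρ) = v`.
    show 1 + (TwoSat.u - 1) = TwoSat.u by ring,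
    show 1 + 2 * (TwoSat.u - 1 + (TwoSat.v + 1 - 2 * TwoSat.u) / 2) = TwoSat.v by ring]
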